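/- Let $\kappa$ be an algebraically closed field of characteristic zero and let $D\subset\mathbb{P}^2$ be an irreducible cubic curve over $\kappa$. For a closed irreducible curve $Y$ in $\mathbb{P}^2\setminus D$, with projective closure $\overline{Y}\subset\mathbb{P}^2$, let $\deg Y$ be the degree of $\overline{Y}$, let $\tilde{\mathcal C}\to\overline{Y}$ be the normalization, let $S\subset\tilde{\mathcal C}$ be the finite set of points lying over $\overline{Y}\cap D$ (so that $\tilde{\mathcal C}\setminus S$ is the normalization of $Y$), and put $$\chi(Y)=2g(\tilde{\mathcal C})-2+\sharp S .$$ **Theorem 4.1.** For every integer $d\ge 1$ there is a closed irreducible curve $Y\subset\mathbb{P}^2\setminus D$ with $\deg Y\ge d$ and $\chi(Y)\le 12$. -/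

import Mathlib

open scoped LinearAlgebra.Projectivization

noncomputable section

/-- An irreducible (reduced) curve in the projective plane over `κ`: an irreducible homogeneous
form in three variables. The degree is the degree of the form. -/
structure IrredPlaneCurve (κ : Type*) [Field κ] where
  form : MvPolynomial (Fin 3) κ
  degree : ℕ
  isHomogeneous : form.IsHomogeneous degree
  irreducible : Irreducible form

namespace IrredPlaneCurve

variable {κ : Type*} [Field κ]

/-- The closed points of the curve, as a subset of the projective plane. -/
def points (C : IrredPlaneCurve κ) : Set (ℙ κ (Fin 3 → κ)) :=
  {P | MvPolynomial.eval P.rep C.form = 0}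

/-- Vanishing may be tested on any homogeneous coordinates of the point. -/
theorem mk_mem_points (C : IrredPlaneCurve κ) (v : Fin 3 → κ) (hv : v ≠ 0) :
    Projectivization.mk κ v hv ∈ C.points ↔ MvPolynomial.eval v C.form = 0 := by
  obtain ⟨a, ha⟩ := Projectivization.exists_smul_eq_mk_rep κ v hv
  have h : MvPolynomial.eval (a • v) C.form
      = (a : κ) ^ C.degree * MvPolynomial.eval v C.form := by
    rw [MvPolynomial.eval_eq', MvPolynomial.eval_eq', Finset.mul_sum]
    refine Finset.sum_congr rfl fun m hm => ?_
    have hdeg : ∑ i, m i = C.degree := by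
      rw [← Finsupp.degree_eq_sum, Finsupp.degree_apply]
      exact (C.isHomogeneous.degree_eq_sum_deg_support hm).symm
    simp only [Units.smul_def, Pi.smul_apply, smul_eq_mul, mul_pow, Finset.prod_mul_distrib,
      Finset.prod_pow_eq_pow_sum, hdeg]
    ring
  change MvPolynomial.eval _ C.form = 0 ↔ _
  rw [← ha, h]
  simp

/-- The homogeneous coordinate ring. -/
abbrev CoordRing (C : IrredPlaneCurve κ) : Type _ :=
  MvPolynomial (Fin 3) κ ⧸ Ideal.span {C.form}

instance (C : IrredPlaneCurve κ) : (Ideal.span {C.form}).IsPrime :=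
  (Ideal.span_singleton_prime C.irreducible.ne_zero).2 C.irreducible.prime

/-- The `i`-th homogeneous coordinate, in the fraction field of the homogeneous coordinate ring. -/
def coord (C : IrredPlaneCurve κ) (i : Fin 3) : FractionRing C.CoordRing :=
  algebraMap C.CoordRing _ (Ideal.Quotient.mk _ (MvPolynomial.X i))

/-- The function field `κ(C)`: the field generated over `κ` by the ratios of the homogeneous
coordinates (a ratio with denominator zero is `0` and contributes nothing). -/
def functionField (C : IrredPlaneCurve κ) : IntermediateField κ (FractionRing C.CoordRing) :=
  IntermediateField.adjoin κ {z | ∃ i j : Fin 3, z = C.coord i / C.coord j}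

/-- The rational function `xᵢ / xⱼ` on the curve. -/
def ratio (C : IrredPlaneCurve κ) (i j : Fin 3) : C.functionField :=
  ⟨C.coord i / C.coord j, IntermediateField.subset_adjoin _ _ ⟨i, j, rfl⟩⟩

end IrredPlaneCurve

/-- The points of the smooth complete model of a function field `K` in one variable over `κ`:
the nontrivial valuation rings of `K` that contain `κ`. -/
def places (κ K : Type*) [Field κ] [Field K] [Algebra κ K] : Set (ValuationSubring K) :=
  {O | (∀ a : κ, algebraMap κ K a ∈ O) ∧ O ≠ ⊤}

/-- The differentials of `K/κ` that are regular at the place `O`: the sums of terms `a db` with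
`a, b ∈ O`. -/
def differentialsRegularAt (κ K : Type*) [Field κ] [Field K] [Algebra κ K]
    (O : ValuationSubring K) : Submodule κ (Ω[K⁄κ]) :=
  Submodule.span κ {η | ∃ a ∈ O, ∃ b ∈ O, η = a • KaehlerDifferential.D κ K b}

/-- The everywhere regular differentials, i.e. the global sections of the canonical sheaf of the
smooth complete model of `K`. -/
def regularDifferentials (κ K : Type*) [Field κ] [Field K] [Algebra κ K] :
    Submodule κ (Ω[K⁄κ]) :=
  ⨅ O ∈ places κ K, differentialsRegularAt κ K O

/-- The genus of (the smooth complete model of) a function field in one variable. -/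
def genus (κ K : Type*) [Field κ] [Field K] [Algebra κ K] : ℕ :=
  Module.finrank κ (regularDifferentials κ K)

/-- The place `O` of `κ(C)` lies over the point `P`: for some coordinate that does not vanish at
`P`, each function `xᵢ / xⱼ` is regular at `O` with value `pᵢ / pⱼ`. In other words the
normalization map sends the point `O` of the smooth model to `P`. -/
def IrredPlaneCurve.LiesOver {κ : Type*} [Field κ] (C : IrredPlaneCurve κ)
    (O : ValuationSubring C.functionField) (P : ℙ κ (Fin 3 → κ)) : Prop :=
  ∃ j : Fin 3, P.rep j ≠ 0 ∧ C.coord j ≠ 0 ∧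
    ∀ i : Fin 3,
      O.valuation (C.ratio i j - algebraMap κ C.functionField (P.rep i / P.rep j)) < 1

/-- A (closed, irreducible) curve `Y` in the complement of the plane curve `D`; it is given by its
projective closure, which is any irreducible plane curve not contained in `D`. -/
structure CurveInComplement {κ : Type*} [Field κ] (D : IrredPlaneCurve κ) where
  closure : IrredPlaneCurve κ
  not_subset : ¬ closure.points ⊆ D.points

namespace CurveInComplement

variable {κ : Type*} [Field κ] {D : IrredPlaneCurve κ}

/-- The points of `Y`. -/
def points (Y : CurveInComplement D) : Set (ℙ κ (Fin 3 → κ)) :=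
  Y.closure.points \ D.points

/-- The degree of the projective closure of `Y`. -/
def degree (Y : CurveInComplement D) : ℕ := Y.closure.degree

/-- The finite set `S` for which the normalization of `Y` is the smooth complete model minus `S`:
the places of the function field lying over points of `D`. -/
def placesAtInfinity (Y : CurveInComplement D) : Set (ValuationSubring Y.closure.functionField) :=
  {O | O ∈ places κ Y.closure.functionField ∧ ∃ P ∈ D.points, Y.closure.LiesOver O P}

/-- The Euler characteristic `χ(Y) = 2g - 2 + #S` of the normalization of `Y`
(with this sign convention). -/
def eulerChar (Y : CurveInComplement D) : ℤ :=
  2 * (genus κ Y.closure.functionField : ℤ) - 2 + (Y.placesAtInfinity.ncard : ℤ)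

end CurveInComplement

end

/-!
# Affine curves of bounded Euler characteristic in the complement of a plane cubic

Rational curves suffice. A triple `x` of rational functions of `s` parametrizes a plane curve; its
function field embeds into `κ(s)`, so the genus is zero (Lüroth's theorem is not needed: regular
differentials pull back injectively to `κ(s)`, where there are none), and a place over a point of
`D` is the restriction of a place of `κ(s)` at which `x` has a pole or the equation `F` of `D`
vanishes. If this happens only at `s = ∞` and for `s ∈ T`, then `χ ≤ #T - 1`. If the curve
passes through many points of some line, without being that line, its degree is large. This is
`exists_curveInComplement_of_parametrization`; what remains is to find parametrizations for which
`F(x)` has few zeros and poles while the number of points on some line is unbounded.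

By `exists_normal_form`, a cubic with a singular point is `q(X) Y + c(X)` in suitable affine
coordinates, and any other has a Weierstrass equation: a flex exists by Krull's height theorem,
since the cubic and its Hessian have a common zero.

* For `q(X) Y + c(X)` put `X = s` and let `Y` be the solution of `q Y + c = c s ^ k`. The poles
  are among the zeros of `q`, the zeros of `F(x)` are zeros of `c` and `s = 0`, and the line `Y = 0`
  is met at all but at most five of the `k`-th roots of unity.
* For the Weierstrass form, with `f(t) = t ^ 3 + a t + b`, a solution of Pell's equation
  `α ^ 2 - f(t) β ^ 2 = 1` with `3 t = q ^ 2` gives a point at which the form is the *constant*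
  `1` (`weierstrass_form_eq_one`). If `m` is a critical point of `f` with critical value
  `e ≠ 0`, then `f(t) - e = (t - m) ^ 2 (t + 2 m)`, so on the conic
  `q ^ 2 + 3 e σ ^ 2 + 6 m = 0` the function `A = (t - m) σ` satisfies `1 - A ^ 2 = f(t) / e`. The
  solutions `T (n + 1)`, `U n` of Pell's equation for `A ^ 2 - 1`, evaluated at `A`, yield
  solutions of the equation above. The conic is parametrized by a coordinate `s` for which all
  functions in question are Laurent polynomials, and the line `Z = 0` is met wherever `A` is a
  root of `U n`.
-/

/-! ### Valuation rings containing the constants -/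

section Places

variable {κ L : Type*} [Field κ] [Field L] [Algebra κ L] {O : ValuationSubring L}

theorem valuation_algebraMap_eq_one (hO : ∀ a : κ, algebraMap κ L a ∈ O) {a : κ} (ha : a ≠ 0) :
    O.valuation (algebraMap κ L a) = 1 := by
  refine le_antisymm ((O.valuation_le_one_iff _).2 (hO a)) ?_
  have h := (O.valuation_le_one_iff _).2 (hO a⁻¹)
  rw [map_inv₀, map_inv₀] at h
  have h0 : O.valuation (algebraMap κ L a) ≠ 0 := by simpa using ha
  exact (inv_le_one₀ (zero_lt_iff.2 h0)).1 h

theorem valuation_mul_lt_one {x y : L} (hx : O.valuation x ≤ 1) (hy : O.valuation y < 1) :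
    O.valuation (x * y) < 1 := by
  rw [map_mul]
  exact mul_lt_one_of_nonneg_of_lt_one_right hx zero_le hy

theorem valuation_mul_sub_mul_lt_one {x y x' y' : L} (hx : O.valuation x ≤ 1)
    (hy' : O.valuation y' ≤ 1) (h : O.valuation (x - x') < 1) (h' : O.valuation (y - y') < 1) :
    O.valuation (x * y - x' * y') < 1 := by
  have e : x * y - x' * y' = x * (y - y') + y' * (x - x') := by ring
  rw [e]
  exact Valuation.map_add_lt _ (valuation_mul_lt_one hx h') (valuation_mul_lt_one hy' h)

theorem valuation_le_one_of_sub_lt {x y : L} (hy : O.valuation y ≤ 1)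
    (h : O.valuation (x - y) < 1) : O.valuation x ≤ 1 := by
  have := Valuation.map_add_le O.valuation h.le hy
  simpa using this

theorem valuation_eq_one_of_sub_lt {x y : L} (hy : O.valuation y = 1)
    (h : O.valuation (x - y) < 1) : O.valuation x = 1 := by
  have := Valuation.map_add_eq_of_lt_right O.valuation (x := x - y) (y := y) (by rwa [hy])
  simpa [hy] using this

/-- A constant in the maximal ideal is zero. -/
theorem eq_zero_of_valuation_lt_one (hO : ∀ a : κ, algebraMap κ L a ∈ O) {a : κ}
    (h : O.valuation (algebraMap κ L a) < 1) : a = 0 := by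
  by_contra ha
  exact h.ne (valuation_algebraMap_eq_one hO ha)

/-- Polynomial expressions respect congruence modulo the maximal ideal. -/
theorem valuation_aeval_sub_eval_lt_one {σ : Type*} (hO : ∀ a : κ, algebraMap κ L a ∈ O)
    {x : σ → L} {c : σ → κ} (h : ∀ i, O.valuation (x i - algebraMap κ L (c i)) < 1)
    (H : MvPolynomial σ κ) :
    O.valuation (MvPolynomial.aeval x H - algebraMap κ L (MvPolynomial.eval c H)) < 1 := by
  have hc (a : κ) : O.valuation (algebraMap κ L a) ≤ 1 := (O.valuation_le_one_iff _).2 (hO a)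
  induction H using MvPolynomial.induction_on with
  | C a => simp
  | add p q hp hq =>
    rw [map_add, map_add, map_add, add_sub_add_comm]
    exact Valuation.map_add_lt _ hp hq
  | mul_X p i hp =>
    rw [map_mul, map_mul, map_mul, MvPolynomial.aeval_X, MvPolynomial.eval_X]
    exact valuation_mul_sub_mul_lt_one (valuation_le_one_of_sub_lt (hc _) hp) (hc _) hp (h i)

theorem valuation_polynomial_aeval_sub_eval_lt_one (hO : ∀ a : κ, algebraMap κ L a ∈ O)
    {x : L} {c : κ} (h : O.valuation (x - algebraMap κ L c) < 1) (p : Polynomial κ) :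
    O.valuation (Polynomial.aeval x p - algebraMap κ L (p.eval c)) < 1 := by
  have hc (a : κ) : O.valuation (algebraMap κ L a) ≤ 1 := (O.valuation_le_one_iff _).2 (hO a)
  induction p using Polynomial.induction_on' with
  | add p q hp hq =>
    rw [map_add, Polynomial.eval_add, map_add, add_sub_add_comm]
    exact Valuation.map_add_lt _ hp hq
  | monomial n a =>
    induction n with
    | zero => simp
    | succ n ih =>
      have h1 : Polynomial.aeval x (Polynomial.monomial (n + 1) a)
          = Polynomial.aeval x (Polynomial.monomial n a) * x := by
        simp [Polynomial.aeval_monomial, pow_succ, mul_assoc]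
      have h2 : (Polynomial.monomial (n + 1) a).eval c = (Polynomial.monomial n a).eval c * c := by
        simp [Polynomial.eval_monomial, pow_succ, mul_assoc]
      rw [h1, h2, map_mul]
      exact valuation_mul_sub_mul_lt_one (valuation_le_one_of_sub_lt (hc _) ih) (hc _) ih h

theorem polynomial_aeval_mem (hO : ∀ a : κ, algebraMap κ L a ∈ O) {x : L} (hx : x ∈ O)
    (p : Polynomial κ) : Polynomial.aeval x p ∈ O := by
  induction p using Polynomial.induction_on' with
  | add p q hp hq => rw [map_add]; exact O.add_mem _ _ hp hq
  | monomial n a =>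
    rw [Polynomial.aeval_monomial]
    exact O.mul_mem _ _ (hO a) (pow_mem hx n)

theorem valuation_polynomial_aeval_eq_one (hO : ∀ a : κ, algebraMap κ L a ∈ O)
    {x : L} {c : κ} (h : O.valuation (x - algebraMap κ L c) < 1) {p : Polynomial κ}
    (hp : p.eval c ≠ 0) : O.valuation (Polynomial.aeval x p) = 1 :=
  valuation_eq_one_of_sub_lt (valuation_algebraMap_eq_one hO hp)
    (valuation_polynomial_aeval_sub_eval_lt_one hO h p)

/-- A transcendental element is centred at the origin of some place. -/
theorem exists_place_valuation_lt_one {u : L} (hu : Transcendental κ u) :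
    ∃ O : ValuationSubring L, (∀ a : κ, algebraMap κ L a ∈ O) ∧ O.valuation u < 1 := by
  let A : Subring L := (Algebra.adjoin κ {u}).toSubring
  let t : A := ⟨u, Algebra.self_mem_adjoin_singleton κ u⟩
  have hne : Ideal.span {t} ≠ ⊤ := by
    intro h
    rw [Ideal.eq_top_iff_one, Ideal.mem_span_singleton] at h
    obtain ⟨b, hb⟩ := h
    have hb' : (1 : L) = u * b := congrArg Subtype.val hb
    have hbm : (b : L) ∈ Algebra.adjoin κ {u} := b.2
    rw [Algebra.adjoin_singleton_eq_range_aeval] at hbm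
    obtain ⟨p, hp⟩ := hbm
    refine hu ⟨Polynomial.X * p - 1, fun h0 => ?_, ?_⟩
    · have := congrArg (Polynomial.eval 0) h0
      simp at this
    · simp only [map_sub, map_mul, Polynomial.aeval_X, map_one]
      exact sub_eq_zero.2 (by rw [hb', ← hp]; rfl)
  obtain ⟨O, h1, h2⟩ := Ideal.image_subset_nonunits_valuationSubring (Ideal.span {t}) hne
  exact ⟨O, fun a => h1 ((Algebra.adjoin κ {u}).algebraMap_mem a),
    h2 ⟨t, Ideal.mem_span_singleton_self t, rfl⟩⟩

/-- In `κ(u)`, an element regular at a place where `u` vanishes is a quotient of polynomials in `u`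
with denominator not vanishing at the origin. -/
theorem exists_eq_aeval_div_aeval {u : L} (hu' : u ≠ 0)
    (hgen : IntermediateField.adjoin κ {u} = ⊤)
    (hO : ∀ a : κ, algebraMap κ L a ∈ O) (hu : O.valuation u < 1) {b : L} (hb : b ∈ O) :
    ∃ p q : Polynomial κ, q.eval 0 ≠ 0 ∧ b = Polynomial.aeval u p / Polynomial.aeval u q := by
  obtain ⟨p, q, h⟩ := (IntermediateField.mem_adjoin_simple_iff κ b).1
    (hgen ▸ IntermediateField.mem_top)
  by_cases hb0 : b = 0
  · exact ⟨0, 1, by simp, by simp [hb0]⟩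
  have hp : p ≠ 0 := by rintro rfl; simp [hb0] at h
  have hq : q ≠ 0 := by rintro rfl; simp [hb0] at h
  have hu0 : O.valuation (u - algebraMap κ L 0) < 1 := by simpa using hu
  obtain ⟨p₁, hp₁, hp₁'⟩ := Polynomial.exists_eq_pow_rootMultiplicity_mul_and_not_dvd p hp 0
  obtain ⟨q₁, hq₁, hq₁'⟩ := Polynomial.exists_eq_pow_rootMultiplicity_mul_and_not_dvd q hq 0
  set i := p.rootMultiplicity 0
  set j := q.rootMultiplicity 0
  rw [Polynomial.dvd_iff_isRoot] at hp₁' hq₁'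
  have vp := valuation_polynomial_aeval_eq_one hO hu0 hp₁'
  have vq := valuation_polynomial_aeval_eq_one hO hu0 hq₁'
  rw [hp₁, hq₁] at h
  simp only [map_mul, map_pow, map_zero, sub_zero, Polynomial.aeval_X] at h
  have hij : j ≤ i := by
    by_contra hlt
    push Not at hlt
    have hb1 := (O.valuation_le_one_iff _).2 hb
    rw [h, map_div₀, map_mul, map_mul, vp, vq, mul_one, mul_one, map_pow, map_pow] at hb1
    have hv0 : O.valuation u ≠ 0 := by simpa using hu'
    rw [div_le_one₀ (pow_pos (zero_lt_iff.2 hv0) _)] at hb1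
    exact absurd hb1 (not_le.2 (pow_lt_pow_right_of_lt_one₀ (zero_lt_iff.2 hv0) hu hlt))
  refine ⟨Polynomial.X ^ (i - j) * p₁, q₁, hq₁', ?_⟩
  rw [h, map_mul, map_pow, Polynomial.aeval_X]
  obtain ⟨k, hk⟩ := Nat.exists_eq_add_of_le hij
  have : Polynomial.aeval u q₁ ≠ 0 := by
    intro h0; rw [h0, map_zero] at vq; exact zero_ne_one vq
  rw [hk, Nat.add_sub_cancel_left, pow_add]
  field_simp

/-- The place of `κ(u)` at which `u` vanishes is unique. -/
theorem place_unique {u : L} (hu' : u ≠ 0) (hgen : IntermediateField.adjoin κ {u} = ⊤)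
    {O₁ O₂ : ValuationSubring L} (h₁ : ∀ a : κ, algebraMap κ L a ∈ O₁)
    (h₂ : ∀ a : κ, algebraMap κ L a ∈ O₂) (hu₁ : O₁.valuation u < 1)
    (hu₂ : O₂.valuation u < 1) : O₁ = O₂ := by
  have key {O₁ O₂ : ValuationSubring L} (h₁ : ∀ a : κ, algebraMap κ L a ∈ O₁)
    (h₂ : ∀ a : κ, algebraMap κ L a ∈ O₂) (hu₁ : O₁.valuation u < 1)
    (hu₂ : O₂.valuation u < 1) : O₁ ≤ O₂ := by
    intro b hb
    obtain ⟨p, q, hq, rfl⟩ := exists_eq_aeval_div_aeval hu' hgen h₁ hu₁ hb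
    have hu0 : O₂.valuation (u - algebraMap κ L 0) < 1 := by simpa using hu₂
    rw [← O₂.valuation_le_one_iff, map_div₀, valuation_polynomial_aeval_eq_one h₂ hu0 hq, div_one,
      O₂.valuation_le_one_iff]
    exact polynomial_aeval_mem h₂ ((O₂.valuation_le_one_iff _).1 hu₂.le) p
  exact le_antisymm (key h₁ h₂ hu₁ hu₂) (key h₂ h₁ hu₂ hu₁)

/-- Every place of a subfield is the restriction of a place of the field. -/
theorem exists_place_comap_eq {K : Type*} [Field K] [Algebra κ K] (ι : K →ₐ[κ] L)
    {O : ValuationSubring K} (hO : ∀ a : κ, algebraMap κ K a ∈ O) :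
    ∃ V : ValuationSubring L, (∀ a : κ, algebraMap κ L a ∈ V) ∧ V.comap (ι : K →+* L) = O := by
  let A : Subring L := O.toSubring.map (ι : K →+* L)
  let f : O →+* A := ((ι : K →+* L).comp O.subtype).codRestrict A
    fun x => Subring.mem_map.2 ⟨x, x.2, rfl⟩
  have hf : Function.Surjective f := by
    rintro ⟨_, x, hx, rfl⟩
    exact ⟨⟨x, hx⟩, rfl⟩
  have hfi : Function.Injective f := fun x y h =>
    Subtype.ext (ι.injective (congrArg Subtype.val h))
  let I := (IsLocalRing.maximalIdeal O).map f
  have hI : I ≠ ⊤ := by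
    intro h
    have h1 : (1 : A) ∈ I := h ▸ trivial
    obtain ⟨x, hx, hx1⟩ := (Ideal.mem_map_iff_of_surjective f hf).1 h1
    have : x = 1 := hfi (by rw [hx1, map_one])
    rw [this] at hx
    exact (Ideal.ne_top_iff_one _).1 (IsLocalRing.maximalIdeal.isMaximal O).ne_top hx
  obtain ⟨V, h1, h2⟩ := Ideal.image_subset_nonunits_valuationSubring I hI
  have hOV {x : K} (hx : x ∈ O) : ι x ∈ V := h1 ⟨x, hx, rfl⟩
  refine ⟨V, fun a => ?_, le_antisymm (fun x hx => ?_) fun x hx => hOV hx⟩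
  · rw [← ι.commutes]; exact hOV (hO a)
  · by_contra hxO
    have hinv : x⁻¹ ∈ O.nonunits := O.inv_mem_nonunits_iff.2 (Or.inr hxO)
    obtain ⟨hm, hm'⟩ := ValuationSubring.mem_nonunits_iff_exists_mem_maximalIdeal.1 hinv
    have : ι x⁻¹ ∈ V.nonunits := h2 ⟨f ⟨x⁻¹, hm⟩, Ideal.mem_map_of_mem f hm', rfl⟩
    rw [map_inv₀, V.inv_mem_nonunits_iff] at this
    rcases this with h0 | h0
    · have : x = 0 := by simpa using h0
      exact hxO (this ▸ O.zero_mem)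
    · exact h0 hx

end Places

/-! ### Regular differentials of rational function fields and their subfields -/

section Differentials

variable {κ L : Type*} [Field κ] [Field L] [Algebra κ L] {O : ValuationSubring L}

theorem D_eq_smul_of_adjoin_eq_top {u : L} (hu' : u ≠ 0)
    (hgen : IntermediateField.adjoin κ {u} = ⊤)
    (hO : ∀ a : κ, algebraMap κ L a ∈ O) (hu : O.valuation u < 1) {b : L} (hb : b ∈ O) :
    ∃ g ∈ O, KaehlerDifferential.D κ L b = g • KaehlerDifferential.D κ L u := by
  obtain ⟨p, q, hq, h⟩ := exists_eq_aeval_div_aeval hu' hgen hO hu hb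
  have hu0 : O.valuation (u - algebraMap κ L 0) < 1 := by simpa using hu
  have huO : u ∈ O := (O.valuation_le_one_iff _).1 hu.le
  have vq := valuation_polynomial_aeval_eq_one hO hu0 hq
  have hq0 : Polynomial.aeval u q ≠ 0 := by
    intro h0; rw [h0, map_zero] at vq; exact zero_ne_one vq
  have hbq : b * Polynomial.aeval u q = Polynomial.aeval u p := by rw [h]; field_simp
  refine ⟨(Polynomial.aeval u q)⁻¹ * (Polynomial.aeval u p.derivative
    - b * Polynomial.aeval u q.derivative), O.mul_mem _ _ ?_ (sub_mem
      (polynomial_aeval_mem hO huO _) (O.mul_mem _ _ hb (polynomial_aeval_mem hO huO _))), ?_⟩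
  · rw [← O.valuation_le_one_iff, map_inv₀, vq, inv_one]
  · have hD := congrArg (KaehlerDifferential.D κ L) hbq
    rw [Derivation.leibniz, Derivation.map_aeval, Derivation.map_aeval] at hD
    rw [mul_smul, eq_inv_smul_iff₀ hq0, sub_smul, ← hD, mul_smul]
    abel

/-- At a place where the generator `u` of `κ(u)` vanishes, `du` generates the regular
differentials. -/
theorem exists_eq_smul_of_mem_differentialsRegularAt {u : L} (hu' : u ≠ 0)
    (hgen : IntermediateField.adjoin κ {u} = ⊤)
    (hO : ∀ a : κ, algebraMap κ L a ∈ O) (hu : O.valuation u < 1) {η : Ω[L⁄κ]}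
    (hη : η ∈ differentialsRegularAt κ L O) :
    ∃ g ∈ O, η = g • KaehlerDifferential.D κ L u := by
  induction hη using Submodule.span_induction with
  | mem x hx =>
    obtain ⟨a, ha, b, hb, rfl⟩ := hx
    obtain ⟨g, hg, h⟩ := D_eq_smul_of_adjoin_eq_top hu' hgen hO hu hb
    exact ⟨a * g, O.mul_mem _ _ ha hg, by rw [h, mul_smul]⟩
  | zero => exact ⟨0, O.zero_mem, by simp⟩
  | add x y _ _ hx hy =>
    obtain ⟨g, hg, rfl⟩ := hx
    obtain ⟨g', hg', rfl⟩ := hy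
    exact ⟨g + g', O.add_mem _ _ hg hg', by rw [add_smul]⟩
  | smul c x _ hx =>
    obtain ⟨g, hg, rfl⟩ := hx
    exact ⟨algebraMap κ L c * g, O.mul_mem _ _ (hO c) hg, by rw [mul_smul, algebraMap_smul]⟩

theorem mem_places_of_valuation_lt_one {u : L} (hu' : u ≠ 0)
    (hO : ∀ a : κ, algebraMap κ L a ∈ O) (hu : O.valuation u < 1) : O ∈ places κ L := by
  refine ⟨hO, fun h => ?_⟩
  have : u⁻¹ ∈ O := h ▸ ValuationSubring.mem_top _
  rw [← O.valuation_le_one_iff, map_inv₀] at this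
  have hv0 : O.valuation u ≠ 0 := by simpa using hu'
  exact absurd hu (not_lt.2 ((inv_le_one₀ (zero_lt_iff.2 hv0)).1 this))

/-- A differential on a subfield that is everywhere regular stays everywhere regular. -/
theorem map_mem_regularDifferentials {K : Type*} [Field K] [Algebra κ K] [Algebra K L]
    [IsScalarTower κ K L] {η : Ω[K⁄κ]} (hη : η ∈ regularDifferentials κ K) :
    KaehlerDifferential.map κ κ K L η ∈ regularDifferentials κ L := by
  simp only [regularDifferentials, Submodule.mem_iInf] at hη ⊢
  intro V hV
  have key : ∀ {η : Ω[K⁄κ]}, η ∈ differentialsRegularAt κ K (V.comap (algebraMap K L)) →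
      KaehlerDifferential.map κ κ K L η ∈ differentialsRegularAt κ L V := by
    intro η h
    induction h using Submodule.span_induction with
    | mem x hx =>
      obtain ⟨a, ha, b, hb, rfl⟩ := hx
      refine Submodule.subset_span ⟨algebraMap K L a, ha, algebraMap K L b, hb, ?_⟩
      rw [map_smul, KaehlerDifferential.map_D, algebraMap_smul]
    | zero => rw [map_zero]; exact Submodule.zero_mem _
    | add x y _ _ hx hy => rw [map_add]; exact Submodule.add_mem _ hx hy
    | smul c x _ hx =>
      rw [← algebraMap_smul K c x, map_smul, algebraMap_smul]
      exact Submodule.smul_mem _ _ hx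
  by_cases htop : V.comap (algebraMap K L) = ⊤
  · -- the place restricts to the trivial valuation ring, where every differential is regular
    apply key
    rw [htop]
    have hsmul (c : K) {x : Ω[K⁄κ]} (hx : x ∈ differentialsRegularAt κ K ⊤) :
        c • x ∈ differentialsRegularAt κ K ⊤ := by
      induction hx using Submodule.span_induction with
      | mem x hx =>
        obtain ⟨a, -, b, -, rfl⟩ := hx
        exact Submodule.subset_span
          ⟨c * a, ValuationSubring.mem_top _, b, ValuationSubring.mem_top _, (mul_smul _ _ _).symm⟩
      | zero => rw [smul_zero]; exact Submodule.zero_mem _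
      | add x y _ _ hx hy => rw [smul_add]; exact Submodule.add_mem _ hx hy
      | smul a x _ hx => rw [smul_comm]; exact Submodule.smul_mem _ _ hx
    have hspan : ∀ x ∈ Submodule.span K (Set.range (KaehlerDifferential.D κ K)),
        x ∈ differentialsRegularAt κ K ⊤ := by
      intro x hx
      induction hx using Submodule.span_induction with
      | mem x hx =>
        obtain ⟨b, rfl⟩ := hx
        exact Submodule.subset_span
          ⟨1, ValuationSubring.mem_top _, b, ValuationSubring.mem_top _, by rw [one_smul]⟩
      | zero => exact Submodule.zero_mem _
      | add x y _ _ hx hy => exact Submodule.add_mem _ hx hy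
      | smul c x _ hx => exact hsmul c hx
    exact hspan η (by rw [KaehlerDifferential.span_range_derivation]; trivial)
  · refine key (hη _ ⟨fun a => ?_, htop⟩)
    rw [ValuationSubring.mem_comap, ← IsScalarTower.algebraMap_apply]
    exact hV.1 a

theorem kaehlerMap_injective [CharZero κ] {K : Type*} [Field K] [Algebra κ K] [Algebra K L]
    [IsScalarTower κ K L] [Algebra.EssFiniteType κ L] :
    Function.Injective (KaehlerDifferential.map κ κ K L) := by
  have : CharZero K := charZero_of_injective_algebraMap (algebraMap κ K).injective
  have : Algebra.EssFiniteType K L := Algebra.EssFiniteType.of_comp κ K L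
  have h1 : Function.Injective (KaehlerDifferential.mapBaseChange κ K L) := by
    rw [injective_iff_map_eq_zero]
    intro x hx
    obtain ⟨y, rfl⟩ := (Algebra.H1Cotangent.exact_δ_mapBaseChange κ K L x).1 hx
    rw [Subsingleton.elim y 0, map_zero]
  intro x y hxy
  have h2 : (1 : L) ⊗ₜ[K] x = (1 : L) ⊗ₜ[K] y := h1 (by simpa using hxy)
  exact Module.FaithfullyFlat.tensorProduct_mk_injective (A := K) (B := L) (Ω[K⁄κ]) h2

end Differentials

section RatFunc

variable {κ : Type*} [Field κ]

instance : Algebra.EssFiniteType κ (RatFunc κ) := by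
  have := Algebra.EssFiniteType.of_isLocalization (R := Polynomial κ) (RatFunc κ)
    (nonZeroDivisors (Polynomial κ))
  exact Algebra.EssFiniteType.comp κ (Polynomial κ) (RatFunc κ)

theorem RatFunc.D_X_ne_zero : KaehlerDifferential.D κ (RatFunc κ) RatFunc.X ≠ 0 := by
  intro h
  have hl := KaehlerDifferential.isLocalizedModule_map κ (Polynomial κ) (RatFunc κ)
    (nonZeroDivisors (Polynomial κ))
  have h' : KaehlerDifferential.map κ κ (Polynomial κ) (RatFunc κ)
      (KaehlerDifferential.D κ (Polynomial κ) Polynomial.X)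
      = KaehlerDifferential.map κ κ (Polynomial κ) (RatFunc κ) 0 := by
    rw [KaehlerDifferential.map_D, map_zero, RatFunc.algebraMap_X, h]
  obtain ⟨c, hc⟩ := (IsLocalizedModule.eq_iff_exists (nonZeroDivisors (Polynomial κ))
    (KaehlerDifferential.map κ κ (Polynomial κ) (RatFunc κ))).1 h'
  have := congrArg (KaehlerDifferential.polynomialEquiv κ) hc
  rw [smul_zero, map_zero, Submonoid.smul_def, map_smul, KaehlerDifferential.polynomialEquiv_D,
    Polynomial.derivative_X, smul_eq_mul, mul_one] at this
  exact nonZeroDivisors.coe_ne_zero c this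

theorem RatFunc.adjoin_X_sub_C (α : κ) :
    IntermediateField.adjoin κ {(RatFunc.X : RatFunc κ) - algebraMap κ _ α} = ⊤ := by
  rw [eq_top_iff, ← RatFunc.adjoin_X, IntermediateField.adjoin_simple_le_iff]
  have := add_mem (IntermediateField.mem_adjoin_simple_self κ
    ((RatFunc.X : RatFunc κ) - algebraMap κ _ α)) (IntermediateField.algebraMap_mem _ α)
  rwa [sub_add_cancel] at this

theorem RatFunc.adjoin_inv_X :
    IntermediateField.adjoin κ {(RatFunc.X : RatFunc κ)⁻¹} = ⊤ := by
  rw [eq_top_iff, ← RatFunc.adjoin_X, IntermediateField.adjoin_simple_le_iff]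
  have := inv_mem (IntermediateField.mem_adjoin_simple_self κ (RatFunc.X : RatFunc κ)⁻¹)
  rwa [inv_inv] at this

theorem RatFunc.exists_place_at (α : κ) : ∃ O : ValuationSubring (RatFunc κ),
    (∀ a : κ, algebraMap κ _ a ∈ O) ∧ O.valuation (RatFunc.X - algebraMap κ _ α) < 1 := by
  apply exists_place_valuation_lt_one
  intro h
  apply RatFunc.transcendental_X (K := κ)
  have := h.add (isAlgebraic_algebraMap α)
  rwa [sub_add_cancel] at this

theorem RatFunc.exists_place_at_infinity : ∃ O : ValuationSubring (RatFunc κ),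
    (∀ a : κ, algebraMap κ _ a ∈ O) ∧ O.valuation (RatFunc.X)⁻¹ < 1 := by
  apply exists_place_valuation_lt_one
  intro h
  apply RatFunc.transcendental_X (K := κ)
  simpa using h.inv

theorem RatFunc.valuation_aeval_X_of_pole {O : ValuationSubring (RatFunc κ)}
    (hO : ∀ a : κ, algebraMap κ (RatFunc κ) a ∈ O) (hX : O.valuation (RatFunc.X)⁻¹ < 1)
    {p : Polynomial κ} (hp : p ≠ 0) :
    O.valuation (Polynomial.aeval (RatFunc.X : RatFunc κ) p)
      = O.valuation RatFunc.X ^ p.natDegree := by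
  have hX0 : (RatFunc.X : RatFunc κ) ≠ 0 := RatFunc.X_ne_zero
  have h0 : O.valuation ((RatFunc.X)⁻¹ - algebraMap κ _ 0) < 1 := by simpa using hX
  have hr : p.reverse.eval 0 ≠ 0 := by
    rw [← Polynomial.coeff_zero_eq_eval_zero, Polynomial.coeff_zero_reverse]
    simpa using hp
  have h1 := valuation_polynomial_aeval_eq_one hO h0 hr
  have h2 : Polynomial.aeval (RatFunc.X : RatFunc κ)⁻¹ p.reverse * RatFunc.X ^ p.natDegree
      = Polynomial.aeval (RatFunc.X : RatFunc κ) p := by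
    let := invertibleOfNonzero hX0
    have := Polynomial.eval₂_reverse_mul_pow (algebraMap κ (RatFunc κ)) RatFunc.X p
    rwa [invOf_eq_inv] at this
  rw [← h2, map_mul, h1, one_mul, map_pow]

/-- The projective line has no nonzero everywhere regular differentials. -/
theorem RatFunc.regularDifferentials_eq_bot [IsAlgClosed κ] :
    regularDifferentials κ (RatFunc κ) = ⊥ := by
  rw [eq_bot_iff]
  intro η hη
  simp only [regularDifferentials, Submodule.mem_iInf] at hη
  have hX0 : (RatFunc.X : RatFunc κ) ≠ 0 := RatFunc.X_ne_zero
  set dX := KaehlerDifferential.D κ (RatFunc κ) RatFunc.X with hdX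
  obtain ⟨O, hO, hOX⟩ := RatFunc.exists_place_at_infinity (κ := κ)
  obtain ⟨g, hg, hηg⟩ := exists_eq_smul_of_mem_differentialsRegularAt (inv_ne_zero hX0)
    RatFunc.adjoin_inv_X hO hOX (hη O (mem_places_of_valuation_lt_one (inv_ne_zero hX0) hO hOX))
  have hDinv : KaehlerDifferential.D κ (RatFunc κ) (RatFunc.X)⁻¹
      = (-(RatFunc.X)⁻¹ ^ 2 : RatFunc κ) • dX := by
    rw [Derivation.leibniz_inv]
  set h : RatFunc κ := g * -(RatFunc.X)⁻¹ ^ 2 with hh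
  have hηh : η = h • dX := by rw [hηg, hDinv, smul_smul]
  by_contra hne
  have hh0 : h ≠ 0 := by
    intro h0; rw [h0, zero_smul] at hηh; exact hne hηh
  -- `h` has no pole at a finite place
  have hreg (α : κ) : h.denom.eval α ≠ 0 := by
    intro hα
    obtain ⟨V, hV, hVα⟩ := RatFunc.exists_place_at α
    have hu0 : (RatFunc.X : RatFunc κ) - algebraMap κ _ α ≠ 0 := by
      intro h0
      apply RatFunc.transcendental_X (K := κ)
      rw [sub_eq_zero.1 h0]
      exact isAlgebraic_algebraMap α
    obtain ⟨g', hg', hηg'⟩ := exists_eq_smul_of_mem_differentialsRegularAt hu0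
      (RatFunc.adjoin_X_sub_C α) hV hVα (hη V (mem_places_of_valuation_lt_one hu0 hV hVα))
    rw [map_sub, Derivation.map_algebraMap, sub_zero, hηh] at hηg'
    have hgg : h = g' := smul_left_injective _ RatFunc.D_X_ne_zero hηg'
    have hnum : h.num.eval α ≠ 0 := by
      intro hn
      have hc := h.isCoprime_num_denom
      obtain ⟨a, b, hab⟩ := hc
      have := congrArg (Polynomial.eval α) hab
      simp [hn, hα] at this
    have h1 := valuation_polynomial_aeval_eq_one hV hVα hnum
    have h2 := valuation_polynomial_aeval_sub_eval_lt_one hV hVα h.denom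
    rw [hα, map_zero, sub_zero] at h2
    have h3 : h * Polynomial.aeval (RatFunc.X : RatFunc κ) h.denom
        = Polynomial.aeval (RatFunc.X : RatFunc κ) h.num := by
      simp only [RatFunc.aeval_X_left_eq_algebraMap]
      nth_rewrite 1 [← RatFunc.num_div_denom h]
      rw [div_mul_cancel₀]
      simpa using h.denom_ne_zero
    have h4 := valuation_mul_lt_one ((V.valuation_le_one_iff _).2 (hgg ▸ hg')) h2
    rw [h3, h1] at h4
    exact lt_irrefl _ h4
  -- hence it is a polynomial
  have hden : h.denom = 1 := by
    have hdeg : h.denom.degree = 0 := by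
      by_contra hd
      obtain ⟨α, hα⟩ := IsAlgClosed.exists_root h.denom hd
      exact hreg α hα
    exact (RatFunc.monic_denom h).natDegree_eq_zero.1
      (Polynomial.natDegree_eq_zero_iff_degree_le_zero.2 hdeg.le)
  have hpoly : h = Polynomial.aeval (RatFunc.X : RatFunc κ) h.num := by
    rw [RatFunc.aeval_X_left_eq_algebraMap]
    nth_rewrite 1 [← RatFunc.num_div_denom h]
    rw [hden, map_one, div_one]
  -- whereas regularity at infinity makes it vanish there to order at least two
  have hv := RatFunc.valuation_aeval_X_of_pole hO hOX (p := h.num) (by simpa using hh0)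
  rw [← hpoly] at hv
  have hv1 : 1 < O.valuation RatFunc.X := by
    rw [map_inv₀] at hOX
    exact (inv_lt_one₀ (zero_lt_iff.2 (by simpa using hX0))).1 hOX
  have hv2 : O.valuation h < 1 := by
    rw [hh, neg_eq_neg_one_mul, ← mul_assoc, pow_two, ← mul_assoc]
    refine valuation_mul_lt_one ?_ hOX
    rw [O.valuation_le_one_iff]
    exact O.mul_mem _ _ (O.mul_mem _ _ hg (O.neg_mem _ O.one_mem))
      ((O.valuation_le_one_iff _).1 hOX.le)
  rw [hv] at hv2
  exact absurd hv2 (not_lt.2 (one_le_pow₀ hv1.le))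

end RatFunc

/-- A function field that embeds into `κ(s)` has genus zero. -/
theorem regularDifferentials_eq_bot_of_algHom {κ K : Type*} [Field κ] [IsAlgClosed κ] [CharZero κ]
    [Field K] [Algebra κ K] (ι : K →ₐ[κ] RatFunc κ) : regularDifferentials κ K = ⊥ := by
  let : Algebra K (RatFunc κ) := (ι : K →+* RatFunc κ).toAlgebra
  have : IsScalarTower κ K (RatFunc κ) :=
    IsScalarTower.of_algebraMap_eq fun a => (ι.commutes a).symm
  rw [eq_bot_iff]
  intro η hη
  have := map_mem_regularDifferentials (L := RatFunc κ) hη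
  rw [RatFunc.regularDifferentials_eq_bot, Submodule.mem_bot] at this
  exact kaehlerMap_injective (by rw [this, map_zero])

/-! ### The plane curve parametrized by three elements of a field -/

section Parametrization

/-- A form of degree `n` scales by `c ^ n`. -/
theorem MvPolynomial.IsHomogeneous.aeval_mul_left {σ κ R : Type*} [CommSemiring κ] [CommSemiring R]
    [Algebra κ R] {H : MvPolynomial σ κ} {n : ℕ} (hH : H.IsHomogeneous n) (c : R) (x : σ → R) :
    MvPolynomial.aeval (fun i => c * x i) H = c ^ n * MvPolynomial.aeval x H := by
  simp only [MvPolynomial.aeval_def, MvPolynomial.eval₂_eq]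
  rw [Finset.mul_sum]
  refine Finset.sum_congr rfl fun m hm => ?_
  have hdeg : ∑ i ∈ m.support, m i = n := (hH.degree_eq_sum_deg_support hm).symm
  simp only [mul_pow, Finset.prod_mul_distrib, Finset.prod_pow_eq_pow_sum, hdeg]
  ring

variable {κ L : Type*} [Field κ] [Field L] [Algebra κ L]

/-- The homogeneous components of `H` at `x` are the coefficients of `H` along the line through
`x`. -/
theorem coeff_aeval_C_mul_X {σ : Type*} (x : σ → L) (H : MvPolynomial σ κ) (n : ℕ) :
    (MvPolynomial.aeval (fun i => Polynomial.C (x i) * Polynomial.X) H).coeff n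
      = MvPolynomial.aeval x (MvPolynomial.homogeneousComponent n H) := by
  induction H using MvPolynomial.induction_on' with
  | monomial d a =>
    have hd := MvPolynomial.isHomogeneous_monomial (R := κ) a (rfl : d.degree = d.degree)
    have h1 : (fun i => Polynomial.C (x i) * Polynomial.X)
        = fun i => Polynomial.X * Polynomial.C (x i) := by
      funext i; rw [mul_comm]
    have h2 : MvPolynomial.aeval (fun i => Polynomial.C (x i)) (MvPolynomial.monomial d a)
        = Polynomial.C (MvPolynomial.aeval x (MvPolynomial.monomial d a)) := by
      simp [MvPolynomial.aeval_monomial, Finsupp.prod, Polynomial.algebraMap_apply]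
    rw [h1, hd.aeval_mul_left, h2, MvPolynomial.homogeneousComponent_of_mem hd]
    rw [mul_comm, Polynomial.coeff_C_mul_X_pow]
    split_ifs with h <;> simp_all
  | add p q hp hq => rw [map_add, map_add, map_add, Polynomial.coeff_add, hp, hq]

theorem aeval_aeval_X_one {R : Type*} [CommRing R] [Algebra κ R] (p : MvPolynomial (Fin 2) κ)
    (r : R) : Polynomial.aeval r (MvPolynomial.aeval ![Polynomial.X, (1 : Polynomial κ)] p)
      = MvPolynomial.aeval ![r, 1] p := by
  rw [← AlgHom.comp_apply, MvPolynomial.comp_aeval]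
  congr 2
  funext i
  fin_cases i <;> simp

/-- A binary form is determined by its value at a point with transcendental ratio. -/
theorem binary_form_eq_zero [Infinite κ] {n : ℕ} {p : MvPolynomial (Fin 2) κ}
    (hp : p.IsHomogeneous n) {a b : L} (hab : Transcendental κ (a / b))
    (h : MvPolynomial.aeval ![a, b] p = 0) : p = 0 := by
  have hb : b ≠ 0 := by
    rintro rfl
    rw [div_zero] at hab
    exact hab isAlgebraic_zero
  set q : Polynomial κ := MvPolynomial.aeval ![Polynomial.X, 1] p
  have hq0 : q = 0 := by
    by_contra hne
    refine hab ⟨q, hne, ?_⟩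
    have h1 : (![a, b] : Fin 2 → L) = fun i => b * ![a / b, 1] i := by
      funext i
      fin_cases i
      · simp; field_simp
      · simp
    rw [h1, hp.aeval_mul_left, ← aeval_aeval_X_one] at h
    exact (mul_eq_zero.1 h).resolve_left (pow_ne_zero _ hb)
  have hX : MvPolynomial.X 1 * p = 0 := by
    apply MvPolynomial.funext
    intro c
    rw [map_mul, MvPolynomial.eval_X, map_zero, mul_eq_zero, or_iff_not_imp_left]
    intro hc
    have h1 : c = fun i => c 1 * ![c 0 / c 1, 1] i := by
      funext i
      fin_cases i
      · simp; field_simp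
      · simp
    have h2 := aeval_aeval_X_one p (c 0 / c 1)
    rw [show MvPolynomial.aeval ![Polynomial.X, 1] p = q from rfl, hq0, map_zero] at h2
    rw [← MvPolynomial.aeval_eq_eval, h1, hp.aeval_mul_left, ← h2, mul_zero]
  exact (mul_eq_zero.1 hX).resolve_left (MvPolynomial.X_ne_zero _)

theorem algebraicIndependent_pair [Infinite κ] {a b : L} (hab : Transcendental κ (a / b)) :
    AlgebraicIndependent κ
      (fun i => Polynomial.C (![a, b] i) * Polynomial.X : Fin 2 → Polynomial L) := by
  rw [algebraicIndependent_iff]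
  intro p hp
  rw [← MvPolynomial.sum_homogeneousComponent p]
  refine Finset.sum_eq_zero fun n _ => ?_
  refine binary_form_eq_zero (MvPolynomial.homogeneousComponent_isHomogeneous n p) hab ?_
  rw [← coeff_aeval_C_mul_X, hp, Polynomial.coeff_zero]

end Parametrization

section ImageCurve

universe u

variable {κ L : Type u} [Field κ] [Field L] [Algebra κ L]

/-- Three elements of a field of transcendence degree one satisfy an irreducible homogeneous
equation. A nonzero form of least degree vanishing at the point is irreducible, because the
polynomials all of whose components vanish there form a prime ideal. -/
theorem exists_irreducible_form (hL : Algebra.trdeg κ L ≤ 1) (x : Fin 3 → L) :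
    ∃ C : IrredPlaneCurve κ, MvPolynomial.aeval x C.form = 0 := by
  classical
  let φ : MvPolynomial (Fin 3) κ →ₐ[κ] Polynomial L :=
    MvPolynomial.aeval fun i => Polynomial.C (x i) * Polynomial.X
  have hφ (H n) : (φ H).coeff n = MvPolynomial.aeval x (MvPolynomial.homogeneousComponent n H) :=
    coeff_aeval_C_mul_X x H n
  have hex : ∃ n, ∃ H : MvPolynomial (Fin 3) κ, H ≠ 0 ∧ H.IsHomogeneous n ∧
      MvPolynomial.aeval x H = 0 := by
    have hdep : ¬ AlgebraicIndependent κ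
        (fun i => Polynomial.C (x i) * Polynomial.X : Fin 3 → Polynomial L) := by
      intro h
      have h1 := h.lift_cardinalMk_le_trdeg
      rw [← trdeg_add_eq κ L (A := Polynomial L), Polynomial.trdeg_of_isDomain] at h1
      have h2 : Algebra.trdeg κ L + 1 ≤ 1 + 1 := by gcongr
      have h3 := h1.trans (Cardinal.lift_le.2 h2)
      simp at h3
      norm_num at h3
    rw [algebraicIndependent_iff] at hdep
    push Not at hdep
    obtain ⟨p, hp, hp0⟩ := hdep
    have : ∃ n, MvPolynomial.homogeneousComponent n p ≠ 0 := by
      by_contra! h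
      apply hp0
      rw [← MvPolynomial.sum_homogeneousComponent p]
      exact Finset.sum_eq_zero fun n _ => h n
    obtain ⟨n, hn⟩ := this
    refine ⟨n, _, hn, MvPolynomial.homogeneousComponent_isHomogeneous n p, ?_⟩
    rw [← hφ]
    rw [show φ p = 0 from hp, Polynomial.coeff_zero]
  obtain ⟨G, hG0, hGh, hGx⟩ := Nat.find_spec hex
  have hmin {m : ℕ} (hm : m < Nat.find hex) {H : MvPolynomial (Fin 3) κ} (hH : H.IsHomogeneous m)
      (hHx : MvPolynomial.aeval x H = 0) : H = 0 := by
    by_contra h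
    exact Nat.find_min hex hm ⟨H, h, hH, hHx⟩
  set N := Nat.find hex
  have hφG : φ G = 0 := by
    ext n
    rw [hφ, MvPolynomial.homogeneousComponent_of_mem hGh]
    split_ifs <;> simp [hGx]
  have hdeg := hGh.totalDegree hG0
  have key {A B : MvPolynomial (Fin 3) κ} (hAB : G = A * B) (hA : φ A = 0) : IsUnit B := by
    have hA0 : A ≠ 0 := by rintro rfl; simp at hAB; exact hG0 hAB
    have hB0 : B ≠ 0 := by rintro rfl; simp at hAB; exact hG0 hAB
    have hd : A.totalDegree + B.totalDegree = N := by
      rw [← MvPolynomial.totalDegree_mul_of_isDomain hA0 hB0, ← hAB, hdeg]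
    have hAN : N ≤ A.totalDegree := by
      by_contra! hlt
      apply hA0
      rw [← MvPolynomial.sum_homogeneousComponent A]
      refine Finset.sum_eq_zero fun n hn => ?_
      refine hmin (m := n) ?_ (MvPolynomial.homogeneousComponent_isHomogeneous n A) ?_
      · rw [Finset.mem_range] at hn; omega
      · rw [← hφ, hA, Polynomial.coeff_zero]
    have hB : B.totalDegree = 0 := by omega
    rw [MvPolynomial.totalDegree_eq_zero_iff_eq_C] at hB
    rw [hB] at hB0 ⊢
    exact (isUnit_iff_ne_zero.2 fun h => hB0 (by rw [h, map_zero])).map MvPolynomial.C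
  refine ⟨⟨G, N, hGh, ?_, fun A B hAB => ?_⟩, hGx⟩
  · intro hu
    have := hu.map (MvPolynomial.aeval x)
    rw [hGx] at this
    exact not_isUnit_zero this
  · have h0 : φ A * φ B = 0 := by rw [← map_mul, ← hAB, hφG]
    rcases mul_eq_zero.1 h0 with h | h
    · exact Or.inr (key hAB h)
    · exact Or.inl (key (hAB.trans (mul_comm A B)) h)

/-- The coordinate ring of a plane curve has transcendence degree at most two. -/
theorem IrredPlaneCurve.trdeg_coordRing_le (C : IrredPlaneCurve κ) :
    Algebra.trdeg κ C.CoordRing ≤ 2 := by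
  by_contra! hlt
  let y : Fin 3 → C.CoordRing := fun i => Ideal.Quotient.mk _ (MvPolynomial.X i)
  have hy (H : MvPolynomial (Fin 3) κ) : MvPolynomial.aeval y H = Ideal.Quotient.mk _ H := by
    have : MvPolynomial.aeval y = Ideal.Quotient.mkₐ κ (Ideal.span {C.form}) := by
      ext i; simp [y]
    rw [this]; rfl
  have htop : Algebra.adjoin κ (Set.range y) = ⊤ := by
    rw [Algebra.adjoin_range_eq_range_aeval, AlgHom.range_eq_top]
    intro z
    obtain ⟨H, rfl⟩ := Ideal.Quotient.mk_surjective z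
    exact ⟨H, hy H⟩
  have halg : Algebra.IsAlgebraic (Algebra.adjoin κ (Set.range y)) C.CoordRing :=
    ⟨fun z => by
      have hz : z ∈ Algebra.adjoin κ (Set.range y) := htop ▸ Algebra.mem_top
      exact isAlgebraic_algebraMap (⟨z, hz⟩ : Algebra.adjoin κ (Set.range y))⟩
  have h3 : Cardinal.lift.{u} (Cardinal.mk (Fin 3)) ≤
      Cardinal.lift.{0} (Algebra.trdeg κ C.CoordRing) := by
    have := (Cardinal.natCast_add_one_le_iff (n := 2)).2 hlt
    simp
    norm_num at this
    exact this
  have hb := Algebra.IsAlgebraic.isTranscendenceBasis_of_lift_le_trdeg_of_finite κ y h3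
  have := (algebraicIndependent_iff.1 hb.1) C.form (by
    rw [hy, Ideal.Quotient.eq_zero_iff_mem]; exact Ideal.mem_span_singleton_self _)
  exact C.irreducible.ne_zero this

/-- If the three elements do not all have constant ratio, the function field of the curve they
parametrize embeds into the field. -/
theorem IrredPlaneCurve.exists_functionField_algHom [Infinite κ] (C : IrredPlaneCurve κ)
    {x : Fin 3 → L} (hC : MvPolynomial.aeval x C.form = 0) {i j : Fin 3}
    (hij : Transcendental κ (x i / x j)) :
    ∃ ι : C.functionField →ₐ[κ] L, ∀ i j, ι (C.ratio i j) = x i / x j := by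
  let φ : MvPolynomial (Fin 3) κ →ₐ[κ] Polynomial L :=
    MvPolynomial.aeval fun i => Polynomial.C (x i) * Polynomial.X
  have hφC : φ C.form = 0 := by
    ext n
    rw [coeff_aeval_C_mul_X, MvPolynomial.homogeneousComponent_of_mem C.isHomogeneous]
    split_ifs <;> simp [hC]
  let ψ : C.CoordRing →ₐ[κ] Polynomial L := Ideal.Quotient.liftₐ _ φ fun a ha => by
    obtain ⟨b, rfl⟩ := Ideal.mem_span_singleton.1 ha
    rw [map_mul, hφC, zero_mul]
  have hψ (H : MvPolynomial (Fin 3) κ) : ψ (Ideal.Quotient.mk _ H) = φ H := rfl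
  let y : Fin 2 → C.CoordRing := ![Ideal.Quotient.mk _ (MvPolynomial.X i),
    Ideal.Quotient.mk _ (MvPolynomial.X j)]
  have hψy : ψ ∘ y = fun k => Polynomial.C (![x i, x j] k) * Polynomial.X := by
    funext k
    fin_cases k <;> simp [y, hψ, φ]
  have hyind : AlgebraicIndependent κ (ψ ∘ y) := hψy ▸ algebraicIndependent_pair hij
  have hyb : IsTranscendenceBasis κ y := by
    refine (hyind.of_comp ψ).isTranscendenceBasis_of_lift_trdeg_le_of_finite ?_
    simpa using C.trdeg_coordRing_le
  have halg := hyb.isAlgebraic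
  have hψinj : Function.Injective ψ := by
    rw [injective_iff_map_eq_zero]
    intro a ha
    by_contra ha0
    have hne := Ideal.comap_ne_bot_of_algebraic_mem (R := Algebra.adjoin κ (Set.range y))
      (I := RingHom.ker ψ) ha0 ha (Algebra.IsAlgebraic.isAlgebraic a)
    obtain ⟨b, hb, hb0⟩ := Submodule.exists_mem_ne_zero_of_ne_bot hne
    have hbm := (Algebra.adjoin_range_eq_range_aeval κ y).le b.2
    obtain ⟨p, hp⟩ := hbm
    have h1 : ψ b = 0 := hb
    have h2 : MvPolynomial.aeval (ψ ∘ y) p = 0 := by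
      rw [← h1, ← hp]
      exact (MvPolynomial.comp_aeval_apply y ψ p).symm
    have h3 := algebraicIndependent_iff.1 hyind p h2
    apply hb0
    apply Subtype.ext
    rw [← hp, h3]
    simp
  have hinj' : Function.Injective
      ((IsScalarTower.toAlgHom κ (Polynomial L) (RatFunc L)).comp ψ) :=
    (IsFractionRing.injective (Polynomial L) (RatFunc L)).comp hψinj
  let Φ : FractionRing C.CoordRing →ₐ[κ] RatFunc L := IsFractionRing.liftAlgHom hinj'
  have hΦ (k : Fin 3) : Φ (C.coord k) = RatFunc.C (x k) * RatFunc.X := by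
    rw [IrredPlaneCurve.coord, IsFractionRing.liftAlgHom_apply, IsFractionRing.lift_algebraMap]
    change algebraMap (Polynomial L) (RatFunc L) (φ (MvPolynomial.X k)) = _
    simp [φ]
  have hΦr (k l : Fin 3) : Φ (C.coord k / C.coord l) = algebraMap L (RatFunc L) (x k / x l) := by
    have hX0 : (RatFunc.X : RatFunc L) ≠ 0 := RatFunc.X_ne_zero
    rw [map_div₀, hΦ, hΦ, mul_div_mul_right _ _ hX0, RatFunc.algebraMap_eq_C, map_div₀]
  let E : L →ₐ[κ] RatFunc L := IsScalarTower.toAlgHom κ L (RatFunc L)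
  have hle : C.functionField ≤ E.fieldRange.comap Φ := by
    rw [IrredPlaneCurve.functionField, IntermediateField.adjoin_le_iff]
    rintro _ ⟨k, l, rfl⟩
    exact ⟨x k / x l, (hΦr k l).symm⟩
  have hmem (z : C.functionField) : Φ z ∈ E.range := hle z.2
  let e := AlgEquiv.ofInjective E E.injective
  refine ⟨(e.symm : E.range →ₐ[κ] L).comp
    ((Φ.comp C.functionField.val).codRestrict E.range hmem), fun k l => ?_⟩
  apply e.injective
  apply Subtype.ext
  simp only [AlgHom.comp_apply]
  change ((e (e.symm _) : E.range) : RatFunc L) = _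
  rw [AlgEquiv.apply_symm_apply]
  exact hΦr k l

theorem RatFunc.trdeg_le_one (κ : Type u) [Field κ] : Algebra.trdeg κ (RatFunc κ) ≤ 1 := by
  have : Algebra.IsAlgebraic (Polynomial κ) (RatFunc κ) :=
    IsLocalization.isAlgebraic (RatFunc κ) (nonZeroDivisors (Polynomial κ))
  rw [← trdeg_add_eq κ (Polynomial κ) (A := RatFunc κ), Polynomial.trdeg_of_isDomain,
    trdeg_eq_zero, add_zero]

end ImageCurve

/-! ### Curves containing a line -/

section Lines

open Matrix

variable {κ : Type*} [Field κ]

/-- A form vanishing at more points of a line than its degree vanishes on the line, also at points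
with coordinates in an extension. -/
theorem aeval_eq_zero_on_line [Infinite κ] {G : MvPolynomial (Fin 3) κ} {n : ℕ}
    (hG : G.IsHomogeneous n) {v w : Fin 3 → κ} {𝒯 : Finset κ} (hcard : n < 𝒯.card)
    (h𝒯 : ∀ τ ∈ 𝒯, MvPolynomial.eval (fun i => v i + τ * w i) G = 0)
    {R : Type*} [CommRing R] [Algebra κ R] (a b : R) :
    MvPolynomial.aeval (fun i => algebraMap κ R (v i) * a + algebraMap κ R (w i) * b) G = 0 := by
  let g : Polynomial κ :=
    MvPolynomial.aeval (fun i => Polynomial.C (v i) + Polynomial.C (w i) * Polynomial.X) G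
  have hg (τ : κ) : g.eval τ = MvPolynomial.eval (fun i => v i + τ * w i) G := by
    rw [← Polynomial.coe_aeval_eq_eval, ← MvPolynomial.aeval_eq_eval,
      MvPolynomial.comp_aeval_apply]
    congr 2
    funext i
    simp [mul_comm τ]
  have hg0 : g = 0 := by
    refine Polynomial.eq_zero_of_natDegree_lt_card_of_eval_eq_zero' g 𝒯
      (fun τ hτ => (hg τ).trans (h𝒯 τ hτ)) (lt_of_le_of_lt ?_ hcard)
    have := MvPolynomial.aeval_natDegree_le G hG.totalDegree_le
      (fun i => Polynomial.C (v i) + Polynomial.C (w i) * Polynomial.X) (n := 1)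
      (fun i => by compute_degree)
    simpa using this
  let P : MvPolynomial (Fin 2) κ := MvPolynomial.aeval
    (fun i => MvPolynomial.C (v i) * MvPolynomial.X 0 + MvPolynomial.C (w i) * MvPolynomial.X 1) G
  have hP : P = 0 := by
    have hX : MvPolynomial.X 0 * P = 0 := by
      apply MvPolynomial.funext
      intro c
      rw [map_mul, MvPolynomial.eval_X, map_zero, mul_eq_zero, or_iff_not_imp_left]
      intro hc
      have h1 : MvPolynomial.eval c P = MvPolynomial.aeval
          (fun i => c 0 * (v i + c 1 / c 0 * w i)) G := by
        rw [← MvPolynomial.aeval_eq_eval, MvPolynomial.comp_aeval_apply]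
        congr 2
        funext i
        simp
        field_simp
      rw [h1, hG.aeval_mul_left, MvPolynomial.aeval_eq_eval, ← hg, hg0,
        Polynomial.eval_zero, mul_zero]
    exact (mul_eq_zero.1 hX).resolve_left (MvPolynomial.X_ne_zero _)
  have h2 : MvPolynomial.aeval ![a, b] P = 0 := by rw [hP, map_zero]
  rw [MvPolynomial.comp_aeval_apply] at h2
  rw [← h2]
  congr 2
  funext i
  simp

/-- The equation of the line through two points of the plane. -/
noncomputable def lineForm (v w : Fin 3 → κ) : MvPolynomial (Fin 3) κ :=
  ∑ i, MvPolynomial.C ((v ⨯₃ w) i) * MvPolynomial.X i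

theorem not_isUnit_lineForm (v w : Fin 3 → κ) : ¬ IsUnit (lineForm v w) := by
  intro h
  have := h.map (MvPolynomial.eval (0 : Fin 3 → κ))
  simp [lineForm] at this

/-- A form that vanishes at more points of a line than its degree is divisible by the equation of
the line. -/
theorem lineForm_dvd [Infinite κ] {G : MvPolynomial (Fin 3) κ} {n : ℕ}
    (hG : G.IsHomogeneous n) {v w : Fin 3 → κ} (hc : v ⨯₃ w ≠ 0) {𝒯 : Finset κ}
    (hcard : n < 𝒯.card)
    (h𝒯 : ∀ τ ∈ 𝒯, MvPolynomial.eval (fun i => v i + τ * w i) G = 0) : lineForm v w ∣ G := by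
  set ℓ := lineForm v w
  obtain ⟨u, hu⟩ : ∃ u : Fin 3 → κ, ∑ i, (v ⨯₃ w) i * u i = 1 := by
    obtain ⟨i, hi⟩ := Function.ne_iff.1 hc
    refine ⟨Pi.single i ((v ⨯₃ w) i)⁻¹, ?_⟩
    rw [Finset.sum_eq_single i]
    · simpa using mul_inv_cancel₀ hi
    · intro j _ hj; simp [hj]
    · simp
  rw [← Ideal.mem_span_singleton, ← Ideal.Quotient.eq_zero_iff_mem]
  set R := MvPolynomial (Fin 3) κ ⧸ Ideal.span {ℓ}
  set X : Fin 3 → R := fun i => Ideal.Quotient.mk _ (MvPolynomial.X i) with hX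
  have hmk : (Ideal.Quotient.mk (Ideal.span {ℓ})) G = MvPolynomial.aeval X G := by
    have : MvPolynomial.aeval X = Ideal.Quotient.mkₐ κ (Ideal.span {ℓ}) := by
      ext i; rw [MvPolynomial.aeval_X]; rfl
    rw [this]; rfl
  have hℓ0 : ∑ i, algebraMap κ R ((v ⨯₃ w) i) * X i = 0 := by
    have : Ideal.Quotient.mk (Ideal.span {ℓ})
      (∑ i, MvPolynomial.C ((v ⨯₃ w) i) * MvPolynomial.X i) = 0 :=
    Ideal.Quotient.eq_zero_iff_mem.2 (Ideal.mem_span_singleton_self _)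
    rw [← this, map_sum]
    simp only [map_mul]
    rfl
  have hu' := congrArg (algebraMap κ R) hu
  simp only [Fin.sum_univ_three, cross_apply, Matrix.cons_val, map_add, map_mul, map_sub,
    map_one] at hℓ0 hu'
  rw [hmk]
  -- Cramer's rule: modulo the equation of the line, the generic point is a combination of `v, w`
  have hXi : X = fun i => algebraMap κ R (v i) *
        (algebraMap κ R (u 0) * (X 1 * algebraMap κ R (w 2) - X 2 * algebraMap κ R (w 1))
          + algebraMap κ R (u 1) * (X 2 * algebraMap κ R (w 0) - X 0 * algebraMap κ R (w 2))
          + algebraMap κ R (u 2) * (X 0 * algebraMap κ R (w 1) - X 1 * algebraMap κ R (w 0)))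
      + algebraMap κ R (w i) *
        (algebraMap κ R (u 0) * (algebraMap κ R (v 1) * X 2 - algebraMap κ R (v 2) * X 1)
          + algebraMap κ R (u 1) * (algebraMap κ R (v 2) * X 0 - algebraMap κ R (v 0) * X 2)
          + algebraMap κ R (u 2) * (algebraMap κ R (v 0) * X 1 - algebraMap κ R (v 1) * X 0))
      := by
    funext i
    fin_cases i
    · simp only [Fin.zero_eta]
      linear_combination (-X 0) * hu' + algebraMap κ R (u 0) * hℓ0
    · simp only [Fin.mk_one]
      linear_combination (-X 1) * hu' + algebraMap κ R (u 1) * hℓ0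
    · simp only [Fin.reduceFinMk]
      linear_combination (-X 2) * hu' + algebraMap κ R (u 2) * hℓ0
  rw [hXi]
  exact aeval_eq_zero_on_line hG hcard h𝒯 _ _
/-- An irreducible form that vanishes at more points of a line than its degree is the equation of
the line. -/
theorem linear_form_eq_zero_of_aeval_eq_zero [Infinite κ] {G : MvPolynomial (Fin 3) κ} {n : ℕ}
    (hG : G.IsHomogeneous n) (hirr : Irreducible G) {v w : Fin 3 → κ} {𝒯 : Finset κ}
    (hcard : n < 𝒯.card)
    (h𝒯 : ∀ τ ∈ 𝒯, MvPolynomial.eval (fun i => v i + τ * w i) G = 0)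
    {L : Type*} [Field L] [Algebra κ L] {x : Fin 3 → L} (hx : MvPolynomial.aeval x G = 0) :
    ∑ i, algebraMap κ L ((v ⨯₃ w) i) * x i = 0 := by
  by_cases hc : v ⨯₃ w = 0
  · simp [hc]
  obtain ⟨b, hb⟩ := lineForm_dvd hG hc hcard h𝒯
  have hbu := (hirr.isUnit_or_isUnit hb).resolve_left (not_isUnit_lineForm v w)
  rw [hb, map_mul] at hx
  have h0 := (mul_eq_zero.1 hx).resolve_right (hbu.map (MvPolynomial.aeval x)).ne_zero
  simpa [lineForm] using h0

/-- An irreducible form of degree at least two vanishes on no line. -/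
theorem exists_eval_ne_zero_on_line [Infinite κ] {G : MvPolynomial (Fin 3) κ} {n : ℕ}
    (hG : G.IsHomogeneous n) (hirr : Irreducible G) (hn : 2 ≤ n) {v w : Fin 3 → κ}
    (hc : v ⨯₃ w ≠ 0) : ∃ τ : κ, MvPolynomial.eval (fun i => v i + τ * w i) G ≠ 0 := by
  by_contra! h
  obtain ⟨𝒯, h𝒯⟩ := Infinite.exists_subset_card_eq κ (n + 1)
  obtain ⟨b, hb⟩ := lineForm_dvd hG hc (𝒯 := 𝒯) (by omega) fun τ _ => h τ
  have hbu := (hirr.isUnit_or_isUnit hb).resolve_left (not_isUnit_lineForm v w)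
  have h1 : G.totalDegree ≤ 1 := by
    rw [hb]
    refine (MvPolynomial.totalDegree_mul _ _).trans ?_
    have hb0 : b.totalDegree = 0 := (MvPolynomial.isUnit_iff_totalDegree_of_isReduced.1 hbu).2
    rw [hb0, add_zero]
    refine (MvPolynomial.totalDegree_finsetSum _ _).trans (Finset.sup_le fun i _ => ?_)
    refine (MvPolynomial.totalDegree_mul _ _).trans ?_
    simp
  rw [hG.totalDegree hirr.ne_zero] at h1
  omega

end Lines

/-! ### The curve swept out by a rational parametrization -/

section Master

open Matrix

universe u

variable {κ : Type u} [Field κ]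

theorem exists_algebraMap_eq_of_isAlgebraic [IsAlgClosed κ] {L : Type*} [Field L] [Algebra κ L]
    {z : L} (hz : IsAlgebraic κ z) : ∃ a : κ, algebraMap κ L a = z :=
  minpoly.mem_range_of_degree_eq_one κ z
    (IsAlgClosed.degree_eq_one_of_irreducible κ (minpoly.irreducible hz.isIntegral))

theorem valuation_comap_lt_one_iff {K L : Type*} [Field K] [Field L] (f : K →+* L)
    (V : ValuationSubring L) (z : K) : (V.comap f).valuation z < 1 ↔ V.valuation (f z) < 1 := by
  rw [← ValuationSubring.mem_nonunits_iff, ← ValuationSubring.mem_nonunits_iff,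
    ValuationSubring.mem_nonunits_iff_or, ValuationSubring.mem_nonunits_iff_or,
    ValuationSubring.mem_comap, map_inv₀, map_eq_zero]

/-- Where the three parametrizing functions are regular and the equation of `D` takes a unit value
on them, the parametrized curve does not meet `D`. -/
theorem not_liesOver_of_valuation_eq_one {L : Type*} [Field L] [Algebra κ L]
    {D C : IrredPlaneCurve κ} {x : Fin 3 → L} {ι : C.functionField →ₐ[κ] L}
    (hι : ∀ i j, ι (C.ratio i j) = x i / x j) {V : ValuationSubring L}
    (hV : ∀ a : κ, algebraMap κ L a ∈ V) (hx : ∀ i, x i ∈ V)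
    (hF : V.valuation (MvPolynomial.aeval x D.form) = 1) {P : ℙ κ (Fin 3 → κ)}
    (hP : P ∈ D.points) : ¬ C.LiesOver (V.comap (ι : C.functionField →+* L)) P := by
  rintro ⟨j, hPj, hCj, h⟩
  have hxj : x j ≠ 0 := by
    have h1 : C.ratio j j = 1 := Subtype.ext (div_self hCj)
    have h2 := hι j j
    rw [h1, map_one] at h2
    rintro h0
    rw [h0, div_zero] at h2
    exact one_ne_zero h2
  have hc (i : Fin 3) : V.valuation ((x j)⁻¹ * x i
      - algebraMap κ L ((P.rep j)⁻¹ * P.rep i)) < 1 := by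
    have := h i
    rw [valuation_comap_lt_one_iff] at this
    simp only [RingHom.coe_coe, map_sub, hι, AlgHom.commutes] at this
    rwa [div_eq_inv_mul, div_eq_inv_mul] at this
  have h1 := valuation_aeval_sub_eval_lt_one hV hc D.form
  have h2 : MvPolynomial.eval (fun i => (P.rep j)⁻¹ * P.rep i) D.form = 0 := by
    rw [← MvPolynomial.aeval_eq_eval, D.isHomogeneous.aeval_mul_left]
    have : MvPolynomial.eval P.rep D.form = 0 := hP
    rw [MvPolynomial.aeval_eq_eval, this, mul_zero]
  rw [h2, map_zero, sub_zero, D.isHomogeneous.aeval_mul_left, map_mul, hF, mul_one, map_pow,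
    map_inv₀] at h1
  have hle := (V.valuation_le_one_iff _).2 (hx j)
  have hpos : 0 < V.valuation (x j) := zero_lt_iff.2 (by simpa using hxj)
  exact absurd h1 (not_lt.2 (one_le_pow₀ ((one_le_inv₀ hpos).2 hle)))

/-- At most `#T + 1` places of `κ(s)` lie over infinity or over a point of `T`. -/
theorem RatFunc.exists_places_subset_range (T : Finset κ) :
    ∃ f : Option T → ValuationSubring (RatFunc κ), ∀ V : ValuationSubring (RatFunc κ),
      (∀ a : κ, algebraMap κ (RatFunc κ) a ∈ V) →
      ¬ (RatFunc.X ∈ V ∧ ∀ α ∈ T, V.valuation (RatFunc.X - algebraMap κ (RatFunc κ) α) = 1) →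
      V ∈ Set.range f := by
  choose g hg hg' using RatFunc.exists_place_at (κ := κ)
  obtain ⟨O, hO, hO'⟩ := RatFunc.exists_place_at_infinity (κ := κ)
  refine ⟨fun o => o.elim O fun α => g α, fun V hV h => ?_⟩
  by_cases hX : RatFunc.X ∈ V
  · have h' : ∃ α ∈ T, V.valuation (RatFunc.X - algebraMap κ (RatFunc κ) α) ≠ 1 := by
      by_contra! h'
      exact h ⟨hX, h'⟩
    obtain ⟨α, hα, hne⟩ := h'
    have hlt := lt_of_le_of_ne ((V.valuation_le_one_iff _).2 (sub_mem hX (hV α))) hne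
    refine ⟨some ⟨α, hα⟩, place_unique ?_ (RatFunc.adjoin_X_sub_C α) (hg α) hV (hg' α) hlt⟩
    intro h0
    apply RatFunc.transcendental_X (K := κ)
    rw [sub_eq_zero.1 h0]
    exact isAlgebraic_algebraMap α
  · exact ⟨none, place_unique (inv_ne_zero RatFunc.X_ne_zero) RatFunc.adjoin_inv_X hO hV hO'
      (V.mem_nonunits_iff.1 (V.inv_mem_nonunits_iff.2 (Or.inr hX)))⟩

/-- If a rational parametrization has residues `v + τ w` for two values of `τ`, then its
coordinates do not all have constant ratio. -/
theorem exists_transcendental_ratio [IsAlgClosed κ] {L : Type*} [Field L] [Algebra κ L]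
    {x : Fin 3 → L} {v w : Fin 3 → κ} {τ τ' : κ} (hne : τ ≠ τ') (hvw : v ⨯₃ w ≠ 0)
    (hx : x ≠ 0)
    {V V' : ValuationSubring L} (hV : ∀ a : κ, algebraMap κ L a ∈ V)
    (hV' : ∀ a : κ, algebraMap κ L a ∈ V')
    (h : ∀ i, V.valuation (x i - algebraMap κ L (v i + τ * w i)) < 1)
    (h' : ∀ i, V'.valuation (x i - algebraMap κ L (v i + τ' * w i)) < 1) :
    ∃ i j, Transcendental κ (x i / x j) := by
  by_contra! hall
  obtain ⟨j, hj⟩ := Function.ne_iff.1 hx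
  have halg (i : Fin 3) : ∃ a : κ, algebraMap κ L a = x i / x j :=
    exists_algebraMap_eq_of_isAlgebraic (not_not.1 (hall i j))
  choose c hc using halg
  have hcj : c j = 1 := by
    apply (algebraMap κ L).injective
    rw [hc, map_one, div_self hj]
  have hprop (i k : Fin 3) : algebraMap κ L (c i) * x k - algebraMap κ L (c k) * x i = 0 := by
    rw [hc, hc]; ring
  have key {V : ValuationSubring L} {τ : κ} (hV : ∀ a : κ, algebraMap κ L a ∈ V)
      (h : ∀ i, V.valuation (x i - algebraMap κ L (v i + τ * w i)) < 1) (i k : Fin 3) :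
      c i * (v k + τ * w k) - c k * (v i + τ * w i) = 0 := by
    have hcl (a : κ) : V.valuation (algebraMap κ L a) ≤ 1 := (V.valuation_le_one_iff _).2 (hV a)
    refine eq_zero_of_valuation_lt_one hV ?_
    have := Valuation.map_sub_lt _ (valuation_mul_lt_one (hcl (c k)) (h i))
      (valuation_mul_lt_one (hcl (c i)) (h k))
    convert! this using 2
    have h3 := hprop i k
    rw [map_sub, map_mul, map_mul]
    linear_combination h3
  have hw (i k : Fin 3) : c i * w k - c k * w i = 0 := by
    have h1 := key hV h i k
    have h2 := key hV' h' i k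
    have h3 : (τ - τ') * (c i * w k - c k * w i) = 0 := by linear_combination h1 - h2
    exact (mul_eq_zero.1 h3).resolve_left (sub_ne_zero.2 hne)
  have hv (i k : Fin 3) : c i * v k - c k * v i = 0 := by
    linear_combination key hV h i k - τ * hw i k
  have hww (i : Fin 3) : w i = c i * w j := by
    linear_combination hw j i - w i * hcj
  have hvv (i : Fin 3) : v i = c i * v j := by
    linear_combination hv j i - v i * hcj
  apply hvw
  have (i k : Fin 3) : v i * w k - v k * w i = 0 := by
    rw [hvv i, hvv k, hww i, hww k]; ring
  rw [cross_apply, this, this, this]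
  ext i
  fin_cases i <;> rfl

/-- Let `x` be a rational parametrization regular outside `T` and infinity, there avoiding `D`, and
passing through the points `v + τ w`, `τ ∈ 𝒯`, of some line. The curve swept out by `x` has
genus zero, at most `#T + 1` points at infinity, and degree at least `#𝒯`. -/
theorem exists_curveInComplement_of_parametrization [IsAlgClosed κ] [CharZero κ]
    (D : IrredPlaneCurve κ) (x : Fin 3 → RatFunc κ) (T 𝒯 : Finset κ) (v w : Fin 3 → κ)
    (hreg : ∀ V : ValuationSubring (RatFunc κ), (∀ a : κ, algebraMap κ (RatFunc κ) a ∈ V) →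
      RatFunc.X ∈ V → (∀ α ∈ T, V.valuation (RatFunc.X - algebraMap κ (RatFunc κ) α) = 1) →
      (∀ i, x i ∈ V) ∧ V.valuation (MvPolynomial.aeval x D.form) = 1)
    (h𝒯 : ∀ τ ∈ 𝒯, MvPolynomial.eval (fun i => v i + τ * w i) D.form ≠ 0 ∧
      ∃ V : ValuationSubring (RatFunc κ), (∀ a : κ, algebraMap κ (RatFunc κ) a ∈ V) ∧
        ∀ i, V.valuation (x i - algebraMap κ (RatFunc κ) (v i + τ * w i)) < 1)
    (hdet : ∑ i, algebraMap κ (RatFunc κ) ((v ⨯₃ w) i) * x i ≠ 0) (hcard : 2 ≤ 𝒯.card) :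
    ∃ Y : CurveInComplement D, 𝒯.card ≤ Y.degree ∧
      Module.Finite κ (regularDifferentials κ Y.closure.functionField) ∧
      Y.placesAtInfinity.Finite ∧ Y.eulerChar ≤ (T.card : ℤ) - 1 := by
  have hvw : v ⨯₃ w ≠ 0 := by
    rintro h; simp [h] at hdet
  have hx0 : x ≠ 0 := by
    rintro rfl; simp at hdet
  obtain ⟨C, hC⟩ := exists_irreducible_form (RatFunc.trdeg_le_one κ) x
  obtain ⟨τ, hτ, τ', hτ', hne⟩ := Finset.one_lt_card.1 hcard
  obtain ⟨hFτ, V, hV, hVx⟩ := h𝒯 τ hτ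
  obtain ⟨-, V', hV', hVx'⟩ := h𝒯 τ' hτ'
  obtain ⟨i, j, hij⟩ := exists_transcendental_ratio hne hvw hx0 hV hV' hVx hVx'
  obtain ⟨ι, hι⟩ := C.exists_functionField_algHom hC hij
  have hCτ {τ : κ} (hτ : τ ∈ 𝒯) : MvPolynomial.eval (fun i => v i + τ * w i) C.form = 0 := by
    obtain ⟨-, V, hV, hVx⟩ := h𝒯 τ hτ
    have := valuation_aeval_sub_eval_lt_one hV hVx C.form
    rw [hC, zero_sub, Valuation.map_neg] at this
    exact eq_zero_of_valuation_lt_one hV this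
  have hsub : ¬ C.points ⊆ D.points := by
    intro h
    have hp : (fun i => v i + τ * w i) ≠ 0 := by
      intro h0
      apply hvw
      have hv (i : Fin 3) : v i = -τ * w i := by
        have hi : v i + τ * w i = 0 := congrFun h0 i
        linear_combination hi
      rw [cross_apply]
      ext i
      fin_cases i <;> simp [hv] <;> ring
    exact hFτ ((D.mk_mem_points _ hp).1 (h ((C.mk_mem_points _ hp).2 (hCτ hτ))))
  obtain ⟨f, hf⟩ := RatFunc.exists_places_subset_range T
  let Y : CurveInComplement D := ⟨C, hsub⟩
  have hbot : regularDifferentials κ C.functionField = ⊥ :=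
    regularDifferentials_eq_bot_of_algHom ι
  have hS : Y.placesAtInfinity ⊆
      Set.range fun o => (f o).comap (ι : C.functionField →+* RatFunc κ) := by
    rintro O ⟨hO, P, hP, hOP⟩
    obtain ⟨V, hV, rfl⟩ := exists_place_comap_eq ι hO.1
    obtain ⟨o, rfl⟩ := hf V hV (by
      rintro ⟨hX, hT⟩
      obtain ⟨h1, h2⟩ := hreg V hV hX hT
      exact not_liesOver_of_valuation_eq_one hι hV h1 h2 hP hOP)
    exact ⟨o, rfl⟩
  refine ⟨Y, ?_, ?_, (Set.finite_range _).subset hS, ?_⟩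
  · by_contra! hlt
    exact hdet (linear_form_eq_zero_of_aeval_eq_zero C.isHomogeneous C.irreducible hlt
      (fun τ hτ => hCτ hτ) hC)
  · change Module.Finite κ (regularDifferentials κ C.functionField)
    rw [hbot]
    infer_instance
  · have hgenus : genus κ Y.closure.functionField = 0 := by
      change Module.finrank κ (regularDifferentials κ C.functionField) = 0
      rw [hbot, finrank_bot]
    have hncard : Y.placesAtInfinity.ncard ≤ T.card + 1 := by
      refine (Set.ncard_le_ncard hS (Set.finite_range _)).trans ?_
      rw [← Set.image_univ]
      refine (Set.ncard_image_le Set.finite_univ).trans ?_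
      simp [Set.ncard_univ]
    rw [CurveInComplement.eulerChar, hgenus]
    push_cast
    have : (Y.placesAtInfinity.ncard : ℤ) ≤ T.card + 1 := by exact_mod_cast hncard
    linarith

end Master

/-! ### Common zeros of two forms -/

section CommonZero

variable {κ : Type*} [Field κ]

/-- The maximal ideal of the origin of affine three-space has height at least three. -/
theorem three_le_height_ker_eval_zero :
    3 ≤ (RingHom.ker (MvPolynomial.eval (0 : Fin 3 → κ))).height := by
  let f₁ : MvPolynomial (Fin 3) κ →ₐ[κ] MvPolynomial (Fin 3) κ :=
    MvPolynomial.aeval ![0, MvPolynomial.X 1, MvPolynomial.X 2]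
  let f₂ : MvPolynomial (Fin 3) κ →ₐ[κ] MvPolynomial (Fin 3) κ :=
    MvPolynomial.aeval ![0, 0, MvPolynomial.X 2]
  have h12 : f₂.comp f₁ = f₂ := by
    ext i
    fin_cases i <;> simp [f₁, f₂]
  have h23 : (MvPolynomial.aeval (0 : Fin 3 → κ)).comp f₂ = MvPolynomial.aeval 0 := by
    ext i
    fin_cases i <;> simp [f₂]
  have l0 : (⊥ : Ideal (MvPolynomial (Fin 3) κ)) < RingHom.ker f₁ := by
    refine bot_lt_iff_ne_bot.2 fun h => ?_
    have : MvPolynomial.X 0 ∈ RingHom.ker f₁ := by simp [RingHom.mem_ker, f₁]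
    rw [h, Ideal.mem_bot] at this
    exact MvPolynomial.X_ne_zero _ this
  have l1 : RingHom.ker f₁ < RingHom.ker f₂ := by
    refine lt_of_le_of_ne (fun p hp => ?_) fun h => ?_
    · rw [RingHom.mem_ker] at hp ⊢
      rw [← h12, AlgHom.comp_apply, hp, map_zero]
    · have : MvPolynomial.X 1 ∈ RingHom.ker f₂ := by simp [RingHom.mem_ker, f₂]
      rw [← h, RingHom.mem_ker] at this
      simp [f₁] at this
  have l2 : RingHom.ker f₂ < RingHom.ker (MvPolynomial.eval (0 : Fin 3 → κ)) := by
    refine lt_of_le_of_ne (fun p hp => ?_) fun h => ?_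
    · rw [RingHom.mem_ker] at hp ⊢
      rw [← MvPolynomial.aeval_eq_eval, ← h23, AlgHom.comp_apply, hp, map_zero]
    · have : MvPolynomial.X 2 ∈ RingHom.ker (MvPolynomial.eval (0 : Fin 3 → κ)) := by
        simp [RingHom.mem_ker]
      rw [← h, RingHom.mem_ker] at this
      simp [f₂] at this
  have p1 : (RingHom.ker f₁).IsPrime := RingHom.ker_isPrime _
  have p2 : (RingHom.ker f₂).IsPrime := RingHom.ker_isPrime _
  have p3 : (RingHom.ker (MvPolynomial.eval (0 : Fin 3 → κ))).IsPrime := RingHom.ker_isPrime _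
  have e0 := Ideal.height_add_one_le_of_lt_of_isPrime l0
  have e1 := Ideal.height_add_one_le_of_lt_of_isPrime l1
  have e2 := Ideal.height_add_one_le_of_lt_of_isPrime l2
  calc (3 : ℕ∞) = 0 + 1 + 1 + 1 := by norm_num
    _ ≤ (⊥ : Ideal (MvPolynomial (Fin 3) κ)).height + 1 + 1 + 1 := by gcongr; exact zero_le
    _ ≤ _ := (add_le_add_left (add_le_add_left e0 1) 1).trans ((add_le_add_left e1 1).trans e2)

/-- Two polynomials in three variables that vanish at the origin vanish at another point. If they
did not, the ideal of the origin would be minimal over them, against Krull's height theorem. -/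
theorem exists_common_zero [IsAlgClosed κ] (F H : MvPolynomial (Fin 3) κ)
    (hF : MvPolynomial.eval 0 F = 0) (hH : MvPolynomial.eval 0 H = 0) :
    ∃ p : Fin 3 → κ, p ≠ 0 ∧ MvPolynomial.eval p F = 0 ∧ MvPolynomial.eval p H = 0 := by
  classical
  by_contra! hno
  set m := RingHom.ker (MvPolynomial.eval (0 : Fin 3 → κ)) with hm
  have hmp : m.IsPrime := RingHom.ker_isPrime _
  let S : Finset (MvPolynomial (Fin 3) κ) := {F, H}
  have hle : Ideal.span (S : Set (MvPolynomial (Fin 3) κ)) ≤ m := by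
    rw [Ideal.span_le]
    intro P hP
    simp only [S, Finset.coe_insert, Finset.coe_singleton, Set.mem_insert_iff,
      Set.mem_singleton_iff] at hP
    rcases hP with rfl | rfl <;> assumption
  obtain ⟨𝔭, h𝔭, h𝔭m⟩ := Ideal.exists_minimalPrimes_le hle
  have hprime : 𝔭.IsPrime := h𝔭.1.1
  have hmle : m ≤ 𝔭 := by
    intro P hP
    rw [← MvPolynomial.IsPrime.vanishingIdeal_zeroLocus (K := κ) 𝔭,
      MvPolynomial.mem_vanishingIdeal_iff]
    intro z hz
    rw [MvPolynomial.mem_zeroLocus_iff] at hz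
    have hz0 : z = 0 := by
      by_contra hne
      have h1 := hz F (h𝔭.1.2 (Ideal.subset_span (by simp [S])))
      have h2 := hz H (h𝔭.1.2 (Ideal.subset_span (by simp [S])))
      rw [MvPolynomial.aeval_eq_eval] at h1 h2
      exact hno z hne h1 h2
    rw [hz0, MvPolynomial.aeval_eq_eval]
    exact hP
  have heq : 𝔭 = m := le_antisymm h𝔭m hmle
  have h2 := Ideal.height_le_card_of_mem_minimalPrimes_span_finset h𝔭
  rw [heq] at h2
  have h3 := (three_le_height_ker_eval_zero (κ := κ)).trans h2
  have h4 : S.card ≤ 2 := Finset.card_le_two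
  have h5 : (3 : ℕ) ≤ S.card := by exact_mod_cast h3
  omega

end CommonZero

/-! ### The polarization of a ternary cubic form -/

section Polarization

open Matrix

variable {κ : Type*} [Field κ]

/-- The trilinear form with coefficients `t`. -/
noncomputable def trilinear (t : Fin 3 → Fin 3 → Fin 3 → κ) (a b c : Fin 3 → κ) : κ :=
  ∑ i, ∑ j, ∑ k, t i j k * a i * b j * c k

/-- Being symmetric under permutation of the three indices. -/
def IsSymmetricTensor (t : Fin 3 → Fin 3 → Fin 3 → κ) : Prop :=
  (∀ i j k, t i j k = t j i k) ∧ ∀ i j k, t i j k = t i k j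

theorem pderiv_comm {σ R : Type*} [CommRing R] (i j : σ) (F : MvPolynomial σ R) :
    MvPolynomial.pderiv i (MvPolynomial.pderiv j F)
      = MvPolynomial.pderiv j (MvPolynomial.pderiv i F) := by
  classical
  let D (k : σ) : Derivation R (MvPolynomial σ R) (MvPolynomial σ R) := MvPolynomial.pderiv k
  have h : ⁅D i, D j⁆ = 0 := by
    apply MvPolynomial.derivation_ext
    intro k
    simp only [D]
    rw [Derivation.commutator_apply, MvPolynomial.pderiv_X, MvPolynomial.pderiv_X]
    by_cases h1 : k = i <;> by_cases h2 : k = j <;> simp [Pi.single_apply, h1, h2]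
    all_goals split_ifs <;> simp
  have := congrArg (fun D => D F) h
  simp only [Derivation.commutator_apply] at this
  exact sub_eq_zero.1 this

/-- A cubic form is the diagonal of a symmetric trilinear form, by Euler's identity applied
three times. -/
theorem exists_tensor_of_cubic [CharZero κ] {F : MvPolynomial (Fin 3) κ} (hF : F.IsHomogeneous 3) :
    ∃ t : Fin 3 → Fin 3 → Fin 3 → κ, IsSymmetricTensor t ∧
      F = ∑ i, ∑ j, ∑ k, MvPolynomial.C (t i j k) *
        (MvPolynomial.X i * MvPolynomial.X j * MvPolynomial.X k) := by
  let d (i j k : Fin 3) : κ := MvPolynomial.coeff 0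
    (MvPolynomial.pderiv k (MvPolynomial.pderiv j (MvPolynomial.pderiv i F)))
  have hd (i j k : Fin 3) : MvPolynomial.pderiv k (MvPolynomial.pderiv j (MvPolynomial.pderiv i F))
      = MvPolynomial.C (d i j k) := by
    have h0 : (MvPolynomial.pderiv k
      (MvPolynomial.pderiv j (MvPolynomial.pderiv i F))).IsHomogeneous 0 :=
        ((hF.pderiv (i := i)).pderiv (i := j)).pderiv (i := k)
    rw [← MvPolynomial.totalDegree_zero_iff_isHomogeneous,
      MvPolynomial.totalDegree_eq_zero_iff_eq_C] at h0
    exact h0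
  have h6 : MvPolynomial.C (6 : κ) * F = ∑ i, ∑ j, ∑ k, MvPolynomial.C (d i j k) *
        (MvPolynomial.X i * MvPolynomial.X j * MvPolynomial.X k) := by
    have e1 := hF.sum_X_mul_pderiv
    have e2 (i : Fin 3) := (hF.pderiv (i := i)).sum_X_mul_pderiv
    have e3 (i j : Fin 3) := ((hF.pderiv (i := i)).pderiv (i := j)).sum_X_mul_pderiv
    simp only [hd, nsmul_eq_mul, Nat.add_one_sub_one, Nat.cast_ofNat,
      Nat.cast_one, one_mul] at e1 e2 e3
    calc MvPolynomial.C (6 : κ) * F = 2 * (3 * F) := by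
          rw [show (MvPolynomial.C (6 : κ) : MvPolynomial (Fin 3) κ) = 6 from map_ofNat _ 6]; ring
      _ = ∑ i, MvPolynomial.X i * (2 * MvPolynomial.pderiv i F) := by
          rw [← e1, Finset.mul_sum]
          exact Finset.sum_congr rfl fun i _ => by ring
      _ = _ := by
          refine Finset.sum_congr rfl fun i _ => ?_
          rw [← e2, Finset.mul_sum]
          refine Finset.sum_congr rfl fun j _ => ?_
          rw [← e3, Finset.mul_sum, Finset.mul_sum]
          exact Finset.sum_congr rfl fun k _ => by ring
  refine ⟨fun i j k => 6⁻¹ * d i j k, ⟨fun i j k => ?_, fun i j k => ?_⟩, ?_⟩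
  · simp only [d]; rw [pderiv_comm j i]
  · simp only [d]; rw [pderiv_comm k j]
  · have : F = MvPolynomial.C (6⁻¹ : κ) * (MvPolynomial.C (6 : κ) * F) := by
      rw [← mul_assoc, ← MvPolynomial.C_mul, inv_mul_cancel₀ (by norm_num), MvPolynomial.C_1,
        one_mul]
    rw [this, h6]
    simp only [Finset.mul_sum, MvPolynomial.C_mul, mul_assoc]

variable {t : Fin 3 → Fin 3 → Fin 3 → κ}

theorem trilinear_comm_left (ht : IsSymmetricTensor t) (a b c : Fin 3 → κ) :
    trilinear t a b c = trilinear t b a c := by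
  unfold trilinear
  rw [Finset.sum_comm]
  refine Finset.sum_congr rfl fun i _ => Finset.sum_congr rfl fun j _ =>
    Finset.sum_congr rfl fun k _ => ?_
  rw [ht.1]; ring

theorem trilinear_comm_right (ht : IsSymmetricTensor t) (a b c : Fin 3 → κ) :
    trilinear t a b c = trilinear t a c b := by
  unfold trilinear
  refine Finset.sum_congr rfl fun i _ => ?_
  rw [Finset.sum_comm]
  refine Finset.sum_congr rfl fun j _ => Finset.sum_congr rfl fun k _ => ?_
  rw [ht.2]; ring

theorem trilinear_add_right (a b c c' : Fin 3 → κ) :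
    trilinear t a b (c + c') = trilinear t a b c + trilinear t a b c' := by
  simp only [trilinear, ← Finset.sum_add_distrib, Pi.add_apply, mul_add]

theorem trilinear_smul_right (a b : Fin 3 → κ) (r : κ) (c : Fin 3 → κ) :
    trilinear t a b (r • c) = r * trilinear t a b c := by
  simp only [trilinear, Finset.mul_sum, Pi.smul_apply, smul_eq_mul]
  refine Finset.sum_congr rfl fun i _ => Finset.sum_congr rfl fun j _ =>
    Finset.sum_congr rfl fun k _ => ?_
  ring

theorem trilinear_add_mid (ht : IsSymmetricTensor t) (a b b' c : Fin 3 → κ) :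
    trilinear t a (b + b') c = trilinear t a b c + trilinear t a b' c := by
  rw [trilinear_comm_right ht, trilinear_add_right, trilinear_comm_right ht a c,
    trilinear_comm_right ht a c]

theorem trilinear_smul_mid (ht : IsSymmetricTensor t) (a : Fin 3 → κ) (r : κ) (b c : Fin 3 → κ) :
    trilinear t a (r • b) c = r * trilinear t a b c := by
  rw [trilinear_comm_right ht, trilinear_smul_right, trilinear_comm_right ht a c]

theorem trilinear_smul_left (ht : IsSymmetricTensor t) (r : κ) (a b c : Fin 3 → κ) :
    trilinear t (r • a) b c = r * trilinear t a b c := by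
  rw [trilinear_comm_left ht, trilinear_smul_mid ht, trilinear_comm_left ht b a]

/-- The cubic form in the coordinates given by three vectors. -/
theorem aeval_cubic_eq (ht : IsSymmetricTensor t) (v p u : Fin 3 → κ)
    {R : Type*} [CommRing R] [Algebra κ R] (X Y Z : R) :
    MvPolynomial.aeval (fun i => algebraMap κ R (v i) * X + algebraMap κ R (p i) * Y
        + algebraMap κ R (u i) * Z)
      (∑ i, ∑ j, ∑ k, MvPolynomial.C (t i j k) *
        (MvPolynomial.X i * MvPolynomial.X j * MvPolynomial.X k))
    = algebraMap κ R (trilinear t v v v) * X ^ 3 + algebraMap κ R (trilinear t p p p) * Y ^ 3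
      + algebraMap κ R (trilinear t u u u) * Z ^ 3
      + 3 * algebraMap κ R (trilinear t p v v) * X ^ 2 * Y
      + 3 * algebraMap κ R (trilinear t p p v) * X * Y ^ 2
      + 3 * algebraMap κ R (trilinear t v v u) * X ^ 2 * Z
      + 3 * algebraMap κ R (trilinear t u u v) * X * Z ^ 2
      + 3 * algebraMap κ R (trilinear t p p u) * Y ^ 2 * Z
      + 3 * algebraMap κ R (trilinear t u u p) * Y * Z ^ 2
      + 6 * algebraMap κ R (trilinear t p v u) * X * Y * Z := by
  have s1 : t 1 0 0 = t 0 0 1 := by rw [ht.1, ht.2]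
  have s2 : t 0 1 0 = t 0 0 1 := by rw [ht.2]
  have s3 : t 2 0 0 = t 0 0 2 := by rw [ht.1, ht.2]
  have s4 : t 0 2 0 = t 0 0 2 := by rw [ht.2]
  have s5 : t 1 0 1 = t 0 1 1 := by rw [ht.1]
  have s6 : t 1 1 0 = t 0 1 1 := by rw [ht.2, ht.1]
  have s7 : t 2 0 2 = t 0 2 2 := by rw [ht.1]
  have s8 : t 2 2 0 = t 0 2 2 := by rw [ht.2, ht.1]
  have s9 : t 1 2 1 = t 1 1 2 := by rw [ht.2]
  have s10 : t 2 1 1 = t 1 1 2 := by rw [ht.1, ht.2]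
  have s11 : t 2 1 2 = t 1 2 2 := by rw [ht.1]
  have s12 : t 2 2 1 = t 1 2 2 := by rw [ht.2, ht.1]
  have s13 : t 0 2 1 = t 0 1 2 := by rw [ht.2]
  have s14 : t 1 0 2 = t 0 1 2 := by rw [ht.1]
  have s15 : t 1 2 0 = t 0 1 2 := by rw [ht.2, ht.1]
  have s16 : t 2 0 1 = t 0 1 2 := by rw [ht.1, ht.2]
  have s17 : t 2 1 0 = t 0 1 2 := by rw [ht.1, ht.2, ht.1]
  simp only [trilinear, Fin.sum_univ_three, map_add, map_mul, MvPolynomial.aeval_X,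
    MvPolynomial.aeval_C, s1, s2, s3, s4, s5, s6, s7, s8, s9, s10, s11, s12, s13, s14, s15, s16,
    s17]
  ring

end Polarization

/-! ### Normal forms of irreducible plane cubics -/

section NormalForm

open Matrix

variable {κ : Type*} [Field κ]

theorem exists_dotProduct_cross_ne_zero {v w : Fin 3 → κ} (h : v ⨯₃ w ≠ 0) :
    ∃ u : Fin 3 → κ, u ⬝ᵥ v ⨯₃ w ≠ 0 := by
  by_contra! h'
  exact h (dotProduct_eq_zero _ fun u => by rw [dotProduct_comm]; exact h' u)

theorem exists_cross_ne_zero {p : Fin 3 → κ} (hp : p ≠ 0) : ∃ v : Fin 3 → κ, v ⨯₃ p ≠ 0 := by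
  by_contra! h
  apply hp
  have h0 := h ![1, 0, 0]
  have h1 := h ![0, 1, 0]
  rw [cross_apply] at h0 h1
  have e1 := congrFun h0 1
  have e2 := congrFun h0 2
  have e3 := congrFun h1 2
  simp at e1 e2 e3
  ext i
  fin_cases i <;> assumption

/-- A linear functional vanishing on a basis is zero. -/
theorem eq_zero_of_dotProduct_eq_zero {v p u f : Fin 3 → κ} (hdet : u ⬝ᵥ v ⨯₃ p ≠ 0)
    (hv : v ⬝ᵥ f = 0) (hp : p ⬝ᵥ f = 0) (hu : u ⬝ᵥ f = 0) : f = 0 := by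
  have key : (u ⬝ᵥ v ⨯₃ p) • f = (u ⬝ᵥ f) • (v ⨯₃ p) + (v ⬝ᵥ f) • (p ⨯₃ u)
      + (p ⬝ᵥ f) • (u ⨯₃ v) := by
    ext i
    fin_cases i <;> simp [cross_apply, dotProduct, Fin.sum_univ_three] <;> ring
  rw [hv, hp, hu] at key
  simpa [hdet] using key

variable {t : Fin 3 → Fin 3 → Fin 3 → κ}

theorem trilinear_eq_dotProduct (a b c : Fin 3 → κ) :
    trilinear t a b c = c ⬝ᵥ fun k => ∑ i, ∑ j, t i j k * a i * b j := by
  simp only [trilinear, dotProduct, Fin.sum_univ_three]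
  ring

/-- `trilinear t a b` vanishes identically if it does on a basis. -/
theorem trilinear_eq_zero_of_basis {v p u : Fin 3 → κ} (hdet : u ⬝ᵥ v ⨯₃ p ≠ 0)
    {a b : Fin 3 → κ} (hv : trilinear t a b v = 0) (hp : trilinear t a b p = 0)
    (hu : trilinear t a b u = 0) (c : Fin 3 → κ) : trilinear t a b c = 0 := by
  rw [trilinear_eq_dotProduct] at hv hp hu ⊢
  rw [eq_zero_of_dotProduct_eq_zero hdet hv hp hu, dotProduct_zero]

/-- On a cubic there is a point at which the Hessian matrix `trilinear t p` is degenerate. -/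
theorem exists_hessian_degenerate [IsAlgClosed κ] (t : Fin 3 → Fin 3 → Fin 3 → κ) :
    ∃ p v : Fin 3 → κ, p ≠ 0 ∧ v ≠ 0 ∧ trilinear t p p p = 0 ∧ ∀ b, trilinear t p b v = 0 := by
  let F : MvPolynomial (Fin 3) κ := ∑ i, ∑ j, ∑ k, MvPolynomial.C (t i j k) *
        (MvPolynomial.X i * MvPolynomial.X j * MvPolynomial.X k)
  let M : Matrix (Fin 3) (Fin 3) (MvPolynomial (Fin 3) κ) :=
    Matrix.of fun j k => ∑ i, MvPolynomial.C (t i j k) * MvPolynomial.X i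
  have hM (p : Fin 3 → κ) : MvPolynomial.eval p M.det
      = (Matrix.of fun j k => ∑ i, t i j k * p i).det := by
    rw [RingHom.map_det]
    congr 1
    ext j k
    simp [M]
  obtain ⟨p, hp, hF, hH⟩ := exists_common_zero F M.det (by simp [F]) (by
    rw [hM]
    have : (Matrix.of fun j k => ∑ i, t i j k * (0 : Fin 3 → κ) i) = 0 := by
      ext j k; simp
    rw [this, Matrix.det_zero])
  rw [hM] at hH
  obtain ⟨v, hv, hMv⟩ := Matrix.exists_mulVec_eq_zero_iff.2 hH
  refine ⟨p, v, hp, hv, ?_, fun b => ?_⟩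
  · rw [← hF]
    simp only [F, trilinear, map_sum, map_mul, MvPolynomial.eval_C, MvPolynomial.eval_X, mul_assoc]
  · have h (j : Fin 3) := congrFun hMv j
    simp only [Matrix.mulVec, dotProduct, Matrix.of_apply, Pi.zero_apply] at h
    have : trilinear t p b v = ∑ j, b j * ∑ k, (∑ i, t i j k * p i) * v k := by
      simp only [trilinear, Fin.sum_univ_three]
      ring
    rw [this]
    simp only [h, mul_zero, Finset.sum_const_zero]

end NormalForm

section Cubic

open Matrix

universe u

variable {κ : Type u} [Field κ]

/-- A cubic with a singular point, put at `p`, is linear in the corresponding coordinate. -/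
theorem exists_normal_form_of_singular [IsAlgClosed κ] [CharZero κ] {F : MvPolynomial (Fin 3) κ}
    (hF : F.IsHomogeneous 3) (hirr : Irreducible F) {t : Fin 3 → Fin 3 → Fin 3 → κ}
    (ht : IsSymmetricTensor t)
    (hFt : F = ∑ i, ∑ j, ∑ k, MvPolynomial.C (t i j k) *
        (MvPolynomial.X i * MvPolynomial.X j * MvPolynomial.X k))
    {p : Fin 3 → κ} (hp : p ≠ 0) (hsing : ∀ b, trilinear t p p b = 0) :
    ∃ v u : Fin 3 → κ, u ⬝ᵥ v ⨯₃ p ≠ 0 ∧ ∃ q c : Polynomial κ, q ≠ 0 ∧ c ≠ 0 ∧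
      q.natDegree ≤ 2 ∧ c.natDegree ≤ 3 ∧ ∀ (R : Type u) [CommRing R] [Algebra κ R] (X Y : R),
        MvPolynomial.aeval (fun i => algebraMap κ R (v i) * X + algebraMap κ R (p i) * Y
          + algebraMap κ R (u i)) F = Y * Polynomial.aeval X q + Polynomial.aeval X c := by
  obtain ⟨v, hv⟩ := exists_cross_ne_zero hp
  obtain ⟨u, hu⟩ := exists_dotProduct_cross_ne_zero hv
  have hexp (R : Type u) [CommRing R] [Algebra κ R] (X Y Z : R) :=
    aeval_cubic_eq ht v p u X Y Z
  simp only [← hFt, hsing, map_zero, zero_mul, mul_zero, add_zero] at hexp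
  have hexpκ (X Y Z : κ) := hexp κ X Y Z
  simp only [Algebra.algebraMap_self, RingHom.id_apply, MvPolynomial.aeval_eq_eval] at hexpκ
  let q : Polynomial κ := Polynomial.C (3 * trilinear t p v v) * Polynomial.X ^ 2
    + Polynomial.C (6 * trilinear t p v u) * Polynomial.X + Polynomial.C (3 * trilinear t u u p)
  let c : Polynomial κ := Polynomial.C (trilinear t v v v) * Polynomial.X ^ 3
    + Polynomial.C (3 * trilinear t v v u) * Polynomial.X ^ 2
    + Polynomial.C (3 * trilinear t u u v) * Polynomial.X + Polynomial.C (trilinear t u u u)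
  refine ⟨v, u, hu, q, c, fun hq => ?_, fun hc => ?_, ?_, ?_, fun R _ _ X Y => ?_⟩
  · -- otherwise the cubic is a union of lines through `p`
    have q2 := congrArg (Polynomial.coeff · 2) hq
    have q1 := congrArg (Polynomial.coeff · 1) hq
    have q0 := congrArg (Polynomial.coeff · 0) hq
    simp [q, Polynomial.coeff_X, Polynomial.coeff_C, Polynomial.coeff_X_pow,
      -map_mul] at q0 q1 q2
    simp only [q0, q1, q2, mul_zero, zero_mul, add_zero] at hexpκ
    obtain ⟨X, Z, hXZ, hroot⟩ : ∃ X Z : κ, (X ≠ 0 ∨ Z ≠ 0) ∧ trilinear t v v v * X ^ 3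
        + trilinear t u u u * Z ^ 3 + 3 * trilinear t v v u * X ^ 2 * Z
        + 3 * trilinear t u u v * X * Z ^ 2 = 0 := by
      by_cases h0 : trilinear t v v v = 0
      · exact ⟨1, 0, Or.inl one_ne_zero, by simp [h0]⟩
      · obtain ⟨x, hx⟩ := IsAlgClosed.exists_root c (by
          rw [Polynomial.degree_cubic h0]; norm_num)
        refine ⟨x, 1, Or.inr one_ne_zero, ?_⟩
        simp [c] at hx
        linear_combination hx
    have hcross : (X • v + Z • u) ⨯₃ p ≠ 0 := by
      intro h
      have h0 := congrFun h 0
      have h1 := congrFun h 1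
      have h2 := congrFun h 2
      simp [cross_apply] at h0 h1 h2
      simp [cross_apply, dotProduct, Fin.sum_univ_three] at hu
      rcases hXZ with hX | hZ
      · refine hu ((mul_eq_zero_iff_left hX).1 ?_)
        linear_combination u 0 * h0 + u 1 * h1 + u 2 * h2
      · refine hu ((mul_eq_zero_iff_left hZ).1 ?_)
        linear_combination -(v 0 * h0 + v 1 * h1 + v 2 * h2)
    obtain ⟨τ, hτ⟩ := exists_eval_ne_zero_on_line hF hirr (by norm_num) hcross
    apply hτ
    have h := hexpκ X τ Z
    rw [hroot] at h
    rw [← h]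
    congr 2
    funext i
    simp
    ring
  · -- otherwise the cubic contains the line through `v` and `u`
    have c3 := congrArg (Polynomial.coeff · 3) hc
    have c2 := congrArg (Polynomial.coeff · 2) hc
    have c1 := congrArg (Polynomial.coeff · 1) hc
    have c0 := congrArg (Polynomial.coeff · 0) hc
    simp [c, Polynomial.coeff_X, Polynomial.coeff_C, Polynomial.coeff_X_pow,
      -map_mul] at c0 c1 c2 c3
    simp only [c0, c1, c2, c3, mul_zero, zero_mul, add_zero, zero_add] at hexpκ
    have hcross : u ⨯₃ v ≠ 0 := by
      intro h
      rw [triple_product_permutation, triple_product_permutation, h, dotProduct_zero] at hu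
      exact hu rfl
    obtain ⟨τ, hτ⟩ := exists_eval_ne_zero_on_line hF hirr (by norm_num) hcross
    apply hτ
    have h := hexpκ τ 0 1
    simp only [mul_zero, zero_mul, add_zero] at h
    rw [← h]
    congr 2
    funext i
    ring
  · simp only [q]; compute_degree
  · simp only [c]; compute_degree
  · have h := hexp R X Y 1
    simp only [mul_one, one_pow] at h
    rw [h]
    simp only [q, c, map_add, map_mul, map_pow, Polynomial.aeval_X, Polynomial.aeval_C, map_ofNat]
    ring

/-- An irreducible plane cubic is either linear in one of three suitable coordinates, or it has
a Weierstrass equation, not that of the cuspidal cubic. In the second case the flex is a point `p`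
at which the Hessian matrix has a kernel vector `v`: the tangent at `p` is the line through `p` and
`v`, and the cubic restricts to a multiple of `X ^ 3` on it. -/
theorem exists_normal_form [IsAlgClosed κ] [CharZero κ] {F : MvPolynomial (Fin 3) κ}
    (hF : F.IsHomogeneous 3) (hirr : Irreducible F) :
    ∃ v p u : Fin 3 → κ, u ⬝ᵥ v ⨯₃ p ≠ 0 ∧
      ((∃ q c : Polynomial κ, q ≠ 0 ∧ c ≠ 0 ∧ q.natDegree ≤ 2 ∧ c.natDegree ≤ 3 ∧
        ∀ (R : Type u) [CommRing R] [Algebra κ R] (X Y : R),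
          MvPolynomial.aeval (fun i => algebraMap κ R (v i) * X + algebraMap κ R (p i) * Y
            + algebraMap κ R (u i)) F = Y * Polynomial.aeval X q + Polynomial.aeval X c) ∨
      ∃ a b : κ, (a ≠ 0 ∨ b ≠ 0) ∧
        ∀ (R : Type u) [CommRing R] [Algebra κ R] (X Y Z : R),
          MvPolynomial.aeval (fun i => algebraMap κ R (v i) * X + algebraMap κ R (p i) * Y
            + algebraMap κ R (u i) * Z) F
          = Y ^ 2 * Z - X ^ 3 - algebraMap κ R a * X * Z ^ 2 - algebraMap κ R b * Z ^ 3) := by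
  obtain ⟨t, ht, hFt⟩ := exists_tensor_of_cubic hF
  by_cases hs : ∃ p : Fin 3 → κ, p ≠ 0 ∧ ∀ b, trilinear t p p b = 0
  · obtain ⟨p, hp, hsing⟩ := hs
    obtain ⟨v, u, hu, h⟩ := exists_normal_form_of_singular hF hirr ht hFt hp hsing
    exact ⟨v, p, u, hu, Or.inl h⟩
  push Not at hs
  obtain ⟨p, v, hp, hv, hppp, hpv⟩ := exists_hessian_degenerate t
  have hcross : v ⨯₃ p ≠ 0 := by
    intro h
    obtain ⟨b, hb⟩ := hs p hp
    obtain ⟨j, hj⟩ := Function.ne_iff.1 hp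
    have h0 := congrFun h 0
    have h1 := congrFun h 1
    have h2 := congrFun h 2
    simp [cross_apply] at h0 h1 h2
    have hvp : v = (v j / p j) • p := by
      ext i
      simp only [Pi.smul_apply, smul_eq_mul]
      rw [div_mul_eq_mul_div, eq_div_iff hj]
      fin_cases j <;> fin_cases i <;> simp <;>
        first
        | linear_combination h0
        | linear_combination h1
        | linear_combination h2
        | linear_combination -h0
        | linear_combination -h1
        | linear_combination -h2
    have := hpv b
    rw [hvp, trilinear_smul_right, trilinear_comm_right ht, mul_eq_zero] at this
    rcases this with h3 | h3
    · rw [h3, zero_smul] at hvp; exact hv hvp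
    · exact hb h3
  obtain ⟨u, hu⟩ := exists_dotProduct_cross_ne_zero hcross
  have hβ : trilinear t p p u ≠ 0 := by
    intro h
    obtain ⟨b, hb⟩ := hs p hp
    exact hb (trilinear_eq_zero_of_basis hu (hpv p) hppp h b)
  have hγ : trilinear t v v v ≠ 0 := by
    intro h
    obtain ⟨τ, hτ⟩ := exists_eval_ne_zero_on_line hF hirr (by norm_num) hcross
    apply hτ
    have h1 := aeval_cubic_eq ht v p u (R := κ) 1 τ 0
    simp only [← hFt, h, hppp, hpv, Algebra.algebraMap_self, RingHom.id_apply,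
      MvPolynomial.aeval_eq_eval] at h1
    simp only [mul_zero, zero_mul, mul_one, add_zero, ne_eq, OfNat.ofNat_ne_zero,
      not_false_eq_true, zero_pow] at h1
    rw [← h1]
    congr 2
    funext i
    ring
  -- normalize the coefficients of `X ^ 3` and `Y ^ 2 * Z`
  obtain ⟨ρ, hρ⟩ := IsAlgClosed.exists_pow_nat_eq (-(trilinear t v v v)⁻¹) (n := 3) (by norm_num)
  obtain ⟨σ, hσ⟩ := IsAlgClosed.exists_pow_nat_eq ((3 * trilinear t p p u)⁻¹) (n := 2) (by norm_num)
  have hρ0 : ρ ≠ 0 := by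
    rintro rfl
    rw [zero_pow (by norm_num), eq_comm, neg_eq_zero, inv_eq_zero] at hρ
    exact hγ hρ
  have hσ0 : σ ≠ 0 := by
    rintro rfl
    rw [zero_pow (by norm_num), eq_comm, inv_eq_zero, mul_eq_zero] at hσ
    exact hβ (hσ.resolve_left (by norm_num))
  -- complete the square and the cube
  set l := -(trilinear t v v u / trilinear t v v v) with hl
  set m := -(trilinear t u u p / (2 * trilinear t p p u)) with hm
  set u' := u + (l • v + m • p) with hu'
  have hpvu' : trilinear t p v u' = 0 := by
    rw [trilinear_comm_right ht]; exact hpv u'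
  have hvvp : trilinear t v v p = 0 := by
    rw [trilinear_comm_right ht, trilinear_comm_left ht]; exact hpv v
  have hvvu' : trilinear t v v u' = 0 := by
    rw [hu', trilinear_add_right, trilinear_add_right, trilinear_smul_right,
      trilinear_smul_right, hvvp, hl]
    field_simp
    ring
  have hppu' : trilinear t p p u' = trilinear t p p u := by
    rw [hu', trilinear_add_right, trilinear_add_right, trilinear_smul_right,
      trilinear_smul_right, hppp, hpv]
    ring
  have hu'u'p : trilinear t u' u' p = 0 := by
    have e1 (c : Fin 3 → κ) : trilinear t p v c = 0 := by
      rw [trilinear_comm_right ht]; exact hpv c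
    have h1 (c : Fin 3 → κ) : trilinear t p u' c = trilinear t p u c + m * trilinear t p p c := by
      rw [hu', trilinear_add_mid ht, trilinear_add_mid ht, trilinear_smul_mid ht,
        trilinear_smul_mid ht, e1]
      ring
    have h2 : trilinear t p u u = trilinear t u u p := by
      rw [trilinear_comm_right ht u u p, trilinear_comm_left ht u p u]
    rw [trilinear_comm_right ht, trilinear_comm_left ht, h1, hppu', trilinear_comm_right ht p u u',
      h1, h2, hm]
    field_simp
    ring
  have hdet' : u' ⬝ᵥ v ⨯₃ p ≠ 0 := by
    rw [hu', add_dotProduct, add_dotProduct, smul_dotProduct, smul_dotProduct, dot_self_cross,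
      dot_cross_self]
    simpa using hu
  have hdet'' : u' ⬝ᵥ (ρ • v) ⨯₃ (σ • p) ≠ 0 := by
    rw [map_smul, map_smul, LinearMap.smul_apply, dotProduct_smul, dotProduct_smul]
    exact smul_ne_zero hσ0 (smul_ne_zero hρ0 hdet')
  have hu'0 : u' ≠ 0 := by
    rintro h; rw [h, zero_dotProduct] at hdet'; exact hdet' rfl
  refine ⟨ρ • v, σ • p, u', hdet'', Or.inr ⟨-3 * (ρ * trilinear t u' u' v),
    -trilinear t u' u' u', ?_, fun R _ _ X Y Z => ?_⟩⟩
  · by_contra! h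
    obtain ⟨b, hb⟩ := hs u' hu'0
    have h1 : trilinear t u' u' v = 0 := by
      have := h.1
      simpa [hρ0] using this
    exact hb (trilinear_eq_zero_of_basis hdet' h1 hu'u'p (neg_eq_zero.1 h.2) b)
  · have h := aeval_cubic_eq ht (ρ • v) (σ • p) u' X Y Z
    rw [← hFt] at h
    rw [h]
    simp only [trilinear_smul_left ht, trilinear_smul_mid ht, trilinear_smul_right, hppp, hpvu',
      hvvu', hppu', hu'u'p, hpv, mul_zero, map_zero, zero_mul, add_zero]
    have e1 : ρ * (ρ * (ρ * trilinear t v v v)) = -1 := by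
      have : ρ * (ρ * (ρ * trilinear t v v v)) = ρ ^ 3 * trilinear t v v v := by ring
      rw [this, hρ]; field_simp
    have e2 : 3 * algebraMap κ R (σ * (σ * trilinear t p p u)) = 1 := by
      have : 3 * (σ * (σ * trilinear t p p u)) = 1 := by
        have : 3 * (σ * (σ * trilinear t p p u)) = σ ^ 2 * (3 * trilinear t p p u) := by ring
        rw [this, hσ, inv_mul_cancel₀ (mul_ne_zero (by norm_num) hβ)]
      have := congrArg (algebraMap κ R) this
      rwa [map_mul, map_ofNat, map_one] at this
    rw [e1]
    simp only [map_neg, map_mul, map_one, map_ofNat] at e2 ⊢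
    linear_combination Y ^ 2 * Z * e2

end Cubic

/-! ### Residues of rational functions -/

section Residues

variable {κ L : Type*} [Field κ] [Field L] [Algebra κ L] {O : ValuationSubring L}

theorem valuation_polynomial_aeval_eq_one_of_roots [IsAlgClosed κ]
    (hO : ∀ a : κ, algebraMap κ L a ∈ O) {x : L} {p : Polynomial κ} (hp : p ≠ 0)
    (h : ∀ α ∈ p.roots, O.valuation (x - algebraMap κ L α) = 1) :
    O.valuation (Polynomial.aeval x p) = 1 := by
  rw [(IsAlgClosed.splits p).eq_prod_roots, map_mul, map_mul, Polynomial.aeval_C,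
    valuation_algebraMap_eq_one hO (Polynomial.leadingCoeff_ne_zero.2 hp), one_mul,
    map_multiset_prod, map_multiset_prod, Multiset.map_map, Multiset.map_map]
  refine Multiset.prod_eq_one fun a ha => ?_
  obtain ⟨α, hα, rfl⟩ := Multiset.mem_map.1 ha
  simpa using h α hα

/-- The function `x` is regular at the place `O`, with value the constant `c`. -/
def IsResidue (O : ValuationSubring L) (x : L) (c : κ) : Prop :=
  O.valuation (x - algebraMap κ L c) < 1

namespace IsResidue

variable {x y : L} {c d : κ}

theorem const (O : ValuationSubring L) (c : κ) : IsResidue O (algebraMap κ L c) c := by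
  simp [IsResidue]

theorem add (hx : IsResidue O x c) (hy : IsResidue O y d) : IsResidue O (x + y) (c + d) := by
  rw [IsResidue, map_add, add_sub_add_comm]
  exact Valuation.map_add_lt _ hx hy

theorem sub (hx : IsResidue O x c) (hy : IsResidue O y d) : IsResidue O (x - y) (c - d) := by
  rw [IsResidue, map_sub (algebraMap κ L), sub_sub_sub_comm]
  exact Valuation.map_sub_lt _ hx hy

theorem mul (hO : ∀ a : κ, algebraMap κ L a ∈ O) (hx : IsResidue O x c) (hy : IsResidue O y d) :
    IsResidue O (x * y) (c * d) := by
  have hc (a : κ) : O.valuation (algebraMap κ L a) ≤ 1 := (O.valuation_le_one_iff _).2 (hO a)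
  rw [IsResidue, map_mul]
  exact valuation_mul_sub_mul_lt_one (valuation_le_one_of_sub_lt (hc _) hx) (hc _) hx hy

theorem pow (hO : ∀ a : κ, algebraMap κ L a ∈ O) (hx : IsResidue O x c) (n : ℕ) :
    IsResidue O (x ^ n) (c ^ n) := by
  induction n with
  | zero => simpa using IsResidue.const O (1 : κ)
  | succ n ih => simpa only [pow_succ] using ih.mul hO hx

theorem inv (hO : ∀ a : κ, algebraMap κ L a ∈ O) (hx : IsResidue O x c) (hc : c ≠ 0) :
    IsResidue O x⁻¹ c⁻¹ := by
  have h1 : O.valuation x = 1 :=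
    valuation_eq_one_of_sub_lt (valuation_algebraMap_eq_one hO hc) hx
  have hx0 : x ≠ 0 := by rintro rfl; simp at h1
  have hc0 : algebraMap κ L c ≠ 0 := by simpa using hc
  have e : x⁻¹ - algebraMap κ L c⁻¹
      = -((x - algebraMap κ L c) * (x⁻¹ * algebraMap κ L c⁻¹)) := by
    rw [map_inv₀]; field_simp; ring
  rw [IsResidue, e, Valuation.map_neg, map_mul, map_mul, map_inv₀, h1,
    valuation_algebraMap_eq_one hO (inv_ne_zero hc), inv_one, one_mul, mul_one]
  exact hx

theorem aeval (hO : ∀ a : κ, algebraMap κ L a ∈ O) (hx : IsResidue O x c) (p : Polynomial κ) :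
    IsResidue O (Polynomial.aeval x p) (p.eval c) :=
  valuation_polynomial_aeval_sub_eval_lt_one hO hx p

/-- A function with a nonzero value is not the zero function. -/
theorem ne_zero (hO : ∀ a : κ, algebraMap κ L a ∈ O) (hx : IsResidue O x c) (hc : c ≠ 0) :
    x ≠ 0 := by
  rintro rfl
  rw [IsResidue, zero_sub, Valuation.map_neg] at hx
  exact hc (eq_zero_of_valuation_lt_one hO hx)

end IsResidue

end Residues

/-! ### Curves in the complement of a cubic with a singular point -/

section Singular

open Matrix

universe u

variable {κ : Type u} [Field κ] [IsAlgClosed κ] [CharZero κ]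

theorem card_nthRootsFinset_one {k : ℕ} (hk : 0 < k) :
    (Polynomial.nthRootsFinset k (1 : κ)).card = k := by
  have : NeZero (k : κ) := ⟨Nat.cast_ne_zero.2 hk.ne'⟩
  obtain ⟨ζ, hζ⟩ := HasEnoughRootsOfUnity.exists_primitiveRoot κ k
  exact hζ.card_nthRootsFinset

/-- If the equation of `D` is `q Y + c` in affine coordinates `X, Y`, the curve
`q Y + c = c X ^ k` meets `D` only where `q`, `c` or `X` vanish or `X` has its pole. It meets
the line `Y = 0` in the `k`-th roots of unity at which `q` and `c` do not vanish. -/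
theorem exists_curve_of_linear_form (D : IrredPlaneCurve κ) {v p u : Fin 3 → κ}
    (hdet : u ⬝ᵥ v ⨯₃ p ≠ 0) {q c : Polynomial κ} (hq : q ≠ 0) (hc : c ≠ 0)
    (hqd : q.natDegree ≤ 2) (hcd : c.natDegree ≤ 3)
    (hF : ∀ (R : Type u) [CommRing R] [Algebra κ R] (X Y : R),
      MvPolynomial.aeval (fun i => algebraMap κ R (v i) * X + algebraMap κ R (p i) * Y
        + algebraMap κ R (u i)) D.form = Y * Polynomial.aeval X q + Polynomial.aeval X c)
    (d : ℕ) :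
    ∃ Y : CurveInComplement D, d ≤ Y.degree ∧
      Module.Finite κ (regularDifferentials κ Y.closure.functionField) ∧
      Y.placesAtInfinity.Finite ∧ Y.eulerChar ≤ 5 := by
  classical
  let k := d + 7
  let s : RatFunc κ := RatFunc.X
  let y : RatFunc κ := Polynomial.aeval s c * (s ^ k - 1) / Polynomial.aeval s q
  let x : Fin 3 → RatFunc κ := fun i => algebraMap κ _ (v i) * s + algebraMap κ _ (p i) * y
    + algebraMap κ _ (u i)
  have haeval {r : Polynomial κ} (hr : r ≠ 0) : Polynomial.aeval s r ≠ 0 := fun h =>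
    RatFunc.transcendental_X (K := κ) ⟨r, hr, h⟩
  have hFx : MvPolynomial.aeval x D.form = Polynomial.aeval s c * s ^ k := by
    rw [hF]
    have := haeval hq
    simp only [y]
    field_simp
    ring
  have hqc : q * c ≠ 0 := mul_ne_zero hq hc
  have hqcX : q * c * Polynomial.X ≠ 0 := mul_ne_zero hqc Polynomial.X_ne_zero
  have hqcd : (q * c).natDegree ≤ 5 := Polynomial.natDegree_mul_le.trans (by omega)
  let 𝒯 : Finset κ := Polynomial.nthRootsFinset k (1 : κ) \ (q * c).roots.toFinset
  have h𝒯card : d + 2 ≤ 𝒯.card := by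
    have h1 := Finset.le_card_sdiff (q * c).roots.toFinset (Polynomial.nthRootsFinset k (1 : κ))
    rw [card_nthRootsFinset_one (by omega)] at h1
    have h2 := (Multiset.toFinset_card_le _).trans (Polynomial.card_roots' (q * c))
    change _ ≤ 𝒯.card at h1
    omega
  have hreg (V : ValuationSubring (RatFunc κ)) (hV : ∀ a : κ, algebraMap κ (RatFunc κ) a ∈ V)
      (hX : RatFunc.X ∈ V)
      (hT : ∀ α ∈ (q * c * Polynomial.X).roots.toFinset,
        V.valuation (RatFunc.X - algebraMap κ (RatFunc κ) α) = 1) :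
      (∀ i, x i ∈ V) ∧ V.valuation (MvPolynomial.aeval x D.form) = 1 := by
    have hroots {r : Polynomial κ} (hr : r ∣ q * c * Polynomial.X) :
        V.valuation (Polynomial.aeval s r) = 1 :=
      valuation_polynomial_aeval_eq_one_of_roots hV (ne_zero_of_dvd_ne_zero hqcX hr) fun α hα =>
        hT α (Multiset.mem_toFinset.2 (Multiset.mem_of_le (Polynomial.roots.le_of_dvd hqcX hr) hα))
    have hs : V.valuation s = 1 := by simpa using hroots (Dvd.intro_left _ rfl)
    have hqV := hroots (r := q) ⟨c * Polynomial.X, by ring⟩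
    have hcV := hroots (r := c) ⟨q * Polynomial.X, by ring⟩
    have hy : y ∈ V := by
      rw [← V.valuation_le_one_iff, map_div₀, map_mul, hqV, hcV, one_mul, div_one,
        V.valuation_le_one_iff]
      exact sub_mem (pow_mem hX k) V.one_mem
    refine ⟨fun i => ?_, ?_⟩
    · exact V.add_mem _ _ (V.add_mem _ _ (V.mul_mem _ _ (hV _) hX) (V.mul_mem _ _ (hV _) hy))
        (hV _)
    · rw [hFx, map_mul, map_pow, hcV, hs, one_pow, one_mul]
  have h𝒯 (τ : κ) (hτ : τ ∈ 𝒯) : MvPolynomial.eval (fun i => u i + τ * v i) D.form ≠ 0 ∧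
      ∃ V : ValuationSubring (RatFunc κ), (∀ a : κ, algebraMap κ (RatFunc κ) a ∈ V) ∧
        ∀ i, V.valuation (x i - algebraMap κ (RatFunc κ) (u i + τ * v i)) < 1 := by
    obtain ⟨h1, h2⟩ := Finset.mem_sdiff.1 hτ
    rw [Polynomial.mem_nthRootsFinset (by omega)] at h1
    have h3 : (q * c).eval τ ≠ 0 := fun h =>
      h2 (Multiset.mem_toFinset.2 ((Polynomial.mem_roots hqc).2 h))
    rw [Polynomial.eval_mul] at h3
    refine ⟨?_, ?_⟩
    · have := hF κ τ 0
      simp only [Algebra.algebraMap_self, RingHom.id_apply, MvPolynomial.aeval_eq_eval, mul_zero,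
        add_zero, zero_mul, zero_add, Polynomial.coe_aeval_eq_eval] at this
      have e : (fun i => u i + τ * v i) = fun i => v i * τ + u i := by
        funext i; ring
      rw [e]
      exact this.trans_ne (right_ne_zero_of_mul h3)
    · obtain ⟨V, hV, hVτ⟩ := RatFunc.exists_place_at τ
      refine ⟨V, hV, fun i => ?_⟩
      have hs : IsResidue V s τ := hVτ
      have hy : IsResidue V y (0 : κ) := by
        have := ((hs.aeval hV c).mul hV ((hs.pow hV k).sub (IsResidue.const V (1 : κ)))).mul hV
          ((hs.aeval hV q).inv hV (left_ne_zero_of_mul h3))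
        rw [map_one, h1, sub_self, mul_zero, zero_mul] at this
        rwa [← div_eq_mul_inv] at this
      have := (((IsResidue.const V (v i)).mul hV hs).add ((IsResidue.const V (p i)).mul hV hy)).add
        (IsResidue.const V (u i))
      have e : v i * τ + p i * 0 + u i = u i + τ * v i := by ring
      rw [e] at this
      exact this
  have hdet : ∑ i, algebraMap κ (RatFunc κ) ((u ⨯₃ v) i) * x i ≠ 0 := by
    have e : ∑ i, algebraMap κ (RatFunc κ) ((u ⨯₃ v) i) * x i
        = algebraMap κ (RatFunc κ) (u ⬝ᵥ v ⨯₃ p) * y := by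
      simp [x, cross_apply, dotProduct, Fin.sum_univ_three]
      ring
    rw [e]
    refine mul_ne_zero (by simpa using hdet) (div_ne_zero (mul_ne_zero (haeval hc) ?_) (haeval hq))
    have := haeval (Polynomial.X_pow_sub_C_ne_zero (show 0 < k by omega) (1 : κ))
    simpa using this
  obtain ⟨Y, hY, hfin, hS, hχ⟩ := exists_curveInComplement_of_parametrization D x
    (q * c * Polynomial.X).roots.toFinset 𝒯 u v hreg h𝒯 hdet (by omega)
  refine ⟨Y, by omega, hfin, hS, hχ.trans ?_⟩
  have h1 := (Multiset.toFinset_card_le _).trans (Polynomial.card_roots' (q * c * Polynomial.X))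
  have h2 : (q * c * Polynomial.X).natDegree ≤ 6 :=
    Polynomial.natDegree_mul_le.trans (by rw [Polynomial.natDegree_X]; omega)
  omega

end Singular

/-! ### Chebyshev polynomials -/

section Chebyshev

open Polynomial

/-- Pell's equation for the Chebyshev polynomials. -/
theorem Polynomial.Chebyshev.T_succ_sq (R : Type*) [CommRing R] (n : ℕ) :
    Chebyshev.T R (n + 1) ^ 2 = 1 + (X ^ 2 - 1) * Chebyshev.U R n ^ 2 := by
  induction n with
  | zero => simp
  | succ n ih =>
    have h1 := Chebyshev.T_eq_X_mul_T_sub_pol_U R n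
    have h2 := Chebyshev.U_eq_X_mul_U_add_T R n
    push_cast
    rw [h2, show (n : ℤ) + 1 + 1 = n + 2 by ring, h1]
    linear_combination ih

theorem Polynomial.Chebyshev.card_roots_toFinset_U {κ : Type*} [Field κ] [DecidableEq κ]
    [IsAlgClosed κ] [CharZero κ] (n : ℕ) : (Chebyshev.U κ n).roots.toFinset.card = n := by
  have h0 : Chebyshev.U κ n ≠ 0 := Chebyshev.U_ne_zero κ n (by omega)
  have hnodup : (Chebyshev.U κ n).roots.Nodup := by
    rw [Multiset.nodup_iff_count_le_one]
    intro r
    rw [count_roots]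
    by_contra! h
    obtain ⟨hr, hr'⟩ := (one_lt_rootMultiplicity_iff_isRoot h0).1 h
    have h1 := congrArg (eval r) (Chebyshev.add_one_mul_T_eq_poly_in_U (R := κ) n)
    have h2 := congrArg (eval r) (Chebyshev.T_succ_sq κ n)
    simp only [eval_mul, eval_add, eval_sub, eval_pow, eval_one, eval_X,
      Int.cast_natCast, eval_natCast, hr.eq_zero, hr'.eq_zero, mul_zero, sub_zero, mul_eq_zero,
      ne_eq, OfNat.ofNat_ne_zero, not_false_eq_true, zero_pow, add_zero] at h1 h2
    rcases h1 with h1 | h1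
    · exact Nat.cast_add_one_ne_zero n h1
    · rw [h1] at h2
      norm_num at h2
  rw [Multiset.toFinset_card_of_nodup hnodup, ← (IsAlgClosed.splits _).natDegree_eq_card_roots,
    Chebyshev.natDegree_U_natCast]

end Chebyshev

/-! ### Curves in the complement of a Weierstrass cubic -/

section ConicParametrization

variable {L : Type*} [Field L]

/-- The coordinate `q` in the parametrization of the conic `q ^ 2 + 3 * e * σ ^ 2 + 6 * m = 0` by
`s = q + c * σ`, where `c ^ 2 = - 3 * e`. -/
noncomputable def conicFst (m s : L) : L := (s - 6 * m / s) / 2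

/-- The coordinate `σ` in the parametrization of the conic `q ^ 2 + 3 * e * σ ^ 2 + 6 * m = 0` by
`s = q + c * σ`, where `c ^ 2 = - 3 * e`. -/
noncomputable def conicSnd (m c s : L) : L := (s + 6 * m / s) / (2 * c)

/-- With `t = q ^ 2 / 3`, the function `A = (t - m) * σ` on the conic, for which
`1 - A ^ 2 = ((t - m) ^ 2 * (t + 2 * m) + e) / e`. -/
noncomputable def conicFun (m c s : L) : L := (conicFst m s ^ 2 / 3 - m) * conicSnd m c s

theorem conicFun_sq [CharZero L] {m c s e : L} (hs : s ≠ 0) (he : e ≠ 0) (hc : c ^ 2 = -3 * e) :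
    e * conicFun m c s ^ 2
      = -((conicFst m s ^ 2 / 3 - m) ^ 2 * (conicFst m s ^ 2 / 3 + 2 * m)) := by
  have hc0 : c ≠ 0 := by
    rintro rfl
    simp [he] at hc
  have he' : e = -c ^ 2 / 3 := by
    rw [hc]; field_simp
  rw [he']
  simp only [conicFun, conicFst, conicSnd]
  field_simp
  ring

/-- The function `A` on the conic takes every nonzero value. -/
theorem exists_conicFun_eq [IsAlgClosed L] [CharZero L] {m c e r : L} (he : e ≠ 0)
    (hc : c ^ 2 = -3 * e) (hr : r ≠ 0) : ∃ s, s ≠ 0 ∧ conicFun m c s = r := by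
  have hc0 : c ≠ 0 := by
    rintro rfl
    simp [he] at hc
  obtain ⟨t, ht⟩ : ∃ t, (t - m) ^ 2 * (t + 2 * m) = -(e * r ^ 2) := by
    obtain ⟨t, ht⟩ := IsAlgClosed.exists_root (Polynomial.C 1 * Polynomial.X ^ 3
      + Polynomial.C 0 * Polynomial.X ^ 2 + Polynomial.C (-3 * m ^ 2) * Polynomial.X
      + Polynomial.C (2 * m ^ 3 + e * r ^ 2)) (by
        rw [Polynomial.degree_cubic one_ne_zero]; norm_num)
    refine ⟨t, ?_⟩
    simp only [Polynomial.IsRoot.def, Polynomial.eval_add, Polynomial.eval_mul,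
      Polynomial.eval_C, Polynomial.eval_pow, Polynomial.eval_X] at ht
    linear_combination ht
  have htm : t - m ≠ 0 := by
    intro h
    rw [h] at ht
    simp [he, hr] at ht
  obtain ⟨q₁, hq₁⟩ := IsAlgClosed.exists_pow_nat_eq (3 * t) (n := 2) (by norm_num)
  set σ := r / (t - m) with hσ
  have hσ0 : σ ≠ 0 := div_ne_zero hr htm
  -- one of the two square roots of `3 * t` gives a nonzero parameter
  obtain ⟨q, hq, hs⟩ : ∃ q, q ^ 2 = 3 * t ∧ q + c * σ ≠ 0 := by
    by_cases h : q₁ + c * σ = 0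
    · refine ⟨-q₁, by rw [neg_sq, hq₁], fun h' => ?_⟩
      have : 2 * (c * σ) = 0 := by linear_combination h + h'
      simp [hc0, hσ0] at this
    · exact ⟨q₁, hq₁, h⟩
  have hconic : (q + c * σ) * (q - c * σ) = -6 * m := by
    have h1 : e * σ ^ 2 = -(t + 2 * m) := by
      rw [hσ]; field_simp; linear_combination ht
    linear_combination hq - σ ^ 2 * hc + 3 * h1
  have h6 : 6 * m / (q + c * σ) = -(q - c * σ) := by
    rw [div_eq_iff hs]; linear_combination hconic
  refine ⟨q + c * σ, hs, ?_⟩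
  have h1 : conicFst m (q + c * σ) = q := by
    rw [conicFst, h6]; ring
  have h2 : conicSnd m c (q + c * σ) = σ := by
    rw [conicSnd, h6]; field_simp; ring
  rw [conicFun, h1, h2, hq, hσ]
  field_simp

end ConicParametrization

section ConicResidues

variable {κ L : Type*} [Field κ] [Field L] [Algebra κ L] {O : ValuationSubring L}

theorem IsResidue.ofNat (O : ValuationSubring L) (n : ℕ) [n.AtLeastTwo] :
    IsResidue O (OfNat.ofNat n : L) (OfNat.ofNat n : κ) := by
  have := IsResidue.const O (OfNat.ofNat n : κ)
  rwa [map_ofNat] at this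

theorem IsResidue.div (hO : ∀ a : κ, algebraMap κ L a ∈ O) {x y : L} {c d : κ}
    (hx : IsResidue O x c) (hy : IsResidue O y d) (hd : d ≠ 0) : IsResidue O (x / y) (c / d) := by
  rw [div_eq_mul_inv, div_eq_mul_inv]
  exact hx.mul hO (hy.inv hO hd)

theorem inv_ofNat_mem (hO : ∀ a : κ, algebraMap κ L a ∈ O) (n : ℕ) [n.AtLeastTwo] :
    (OfNat.ofNat n : L)⁻¹ ∈ O := by
  have := hO (OfNat.ofNat n)⁻¹
  rwa [map_inv₀, map_ofNat] at this

theorem isResidue_conicFst [CharZero κ] (hO : ∀ a : κ, algebraMap κ L a ∈ O) {s : L} {s₀ : κ}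
    (m : κ) (hs : IsResidue O s s₀) (hs₀ : s₀ ≠ 0) :
    IsResidue O (conicFst (algebraMap κ L m) s) (conicFst m s₀) :=
  (hs.sub (((IsResidue.ofNat O 6).mul hO (.const O m)).div hO hs hs₀)).div hO (.ofNat O 2)
    (by norm_num)

theorem isResidue_conicFun [CharZero κ] (hO : ∀ a : κ, algebraMap κ L a ∈ O) {s : L} {s₀ : κ}
    (m : κ) {c : κ} (hc : c ≠ 0) (hs : IsResidue O s s₀) (hs₀ : s₀ ≠ 0) :
    IsResidue O (conicFun (algebraMap κ L m) (algebraMap κ L c) s) (conicFun m c s₀) :=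
  ((((isResidue_conicFst hO m hs hs₀).pow hO 2).div hO (.ofNat O 3) (by norm_num)).sub
    (.const O m)).mul hO
  ((hs.add (((IsResidue.ofNat O 6).mul hO (.const O m)).div hO hs hs₀)).div hO
    ((IsResidue.ofNat O 2).mul hO (.const O c)) (mul_ne_zero (by norm_num) hc))

theorem conicFst_mem (hO : ∀ a : κ, algebraMap κ L a ∈ O) {s : L} (m : κ)
    (hs : s ∈ O) (hs' : s⁻¹ ∈ O) : conicFst (algebraMap κ L m) s ∈ O := by
  have h6 : (6 : L) ∈ O := ofNat_mem O 6
  simp only [conicFst, div_eq_mul_inv]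
  exact mul_mem (sub_mem hs (mul_mem (mul_mem h6 (hO m)) hs')) (inv_ofNat_mem hO 2)

theorem conicFun_mem (hO : ∀ a : κ, algebraMap κ L a ∈ O) {s : L} (m c : κ)
    (hs : s ∈ O) (hs' : s⁻¹ ∈ O) :
    conicFun (algebraMap κ L m) (algebraMap κ L c) s ∈ O := by
  have h6 : (6 : L) ∈ O := ofNat_mem O 6
  have hc : (algebraMap κ L c)⁻¹ ∈ O := by simpa using hO c⁻¹
  simp only [conicFun, conicSnd, div_eq_mul_inv, mul_inv]
  exact mul_mem
    (sub_mem (mul_mem (pow_mem (conicFst_mem hO m hs hs') 2) (inv_ofNat_mem hO 3)) (hO m))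
    (mul_mem (add_mem hs (mul_mem (mul_mem h6 (hO m)) hs')) (mul_mem (inv_ofNat_mem hO 2) hc))

end ConicResidues

section Weierstrass

open Matrix

universe u

/-- From a solution of Pell's equation `α ^ 2 - f(t) * β ^ 2 = 1`, where
`f(t) = t ^ 3 + a * t + b` and `q ^ 2 = 3 * t`, one gets a point at which the Weierstrass form
takes the value `1`. -/
theorem weierstrass_form_eq_one {R : Type*} [CommRing R] {a b t q α β y z : R} (hq : q ^ 2 = 3 * t)
    (hN : α ^ 2 = 1 + (t ^ 3 + a * t + b) * β ^ 2)
    (hz : z = β * (2 * α * q - β * (3 * t ^ 2 + a)))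
    (hy : y = q * (1 + 2 * (t ^ 3 + a * t + b) * β ^ 2) - α * β * (3 * t ^ 2 + a)) :
    y ^ 2 * z - (t * z - 1) ^ 3 - a * (t * z - 1) * z ^ 2 - b * z ^ 3 = 1 := by
  have h : y ^ 2 = (t ^ 3 + a * t + b) * z ^ 2 - (3 * t ^ 2 + a) * z + 3 * t := by
    rw [hy, hz]
    linear_combination ((3 * t ^ 2 + a) ^ 2 * β ^ 2
      - 4 * (t ^ 3 + a * t + b) * β ^ 2 * q ^ 2) * hN + hq
  linear_combination z * h

/-- The cubic `t ^ 3 + a * t + b` has a critical point `m` with nonzero critical value. -/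
theorem exists_critical_value_ne_zero {κ : Type*} [Field κ] [IsAlgClosed κ] [CharZero κ] {a b : κ}
    (hab : a ≠ 0 ∨ b ≠ 0) : ∃ m : κ, a = -3 * m ^ 2 ∧ b - 2 * m ^ 3 ≠ 0 := by
  obtain ⟨m, hm⟩ := IsAlgClosed.exists_pow_nat_eq (-a / 3) (n := 2) (by norm_num)
  have ha : a = -3 * m ^ 2 := by rw [hm]; field_simp
  by_cases h : b - 2 * m ^ 3 = 0
  · refine ⟨-m, by rw [neg_sq, ha], fun h' => ?_⟩
    have h1 : 4 * m ^ 3 = 0 := by linear_combination h' - h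
    have hm0 : m = 0 := by simpa using h1
    subst hm0
    simp at ha h
    simp [ha, h] at hab
  · exact ⟨m, ha, h⟩

variable {κ : Type u} [Field κ] [IsAlgClosed κ] [CharZero κ]

/-- A cubic with a Weierstrass equation has, in its complement, curves of genus zero with one point
at infinity and arbitrarily large degree: on them the Weierstrass form is the constant `1`, and the
coordinates are Laurent polynomials. They meet the line `Z = 0` in many points, since the
Chebyshev polynomials `U n` have many roots. -/
theorem exists_curve_of_weierstrass_form (D : IrredPlaneCurve κ) {v p u : Fin 3 → κ}
    (hdet : u ⬝ᵥ v ⨯₃ p ≠ 0) {a b : κ} (hab : a ≠ 0 ∨ b ≠ 0)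
    (hF : ∀ (R : Type u) [CommRing R] [Algebra κ R] (X Y Z : R),
      MvPolynomial.aeval (fun i => algebraMap κ R (v i) * X + algebraMap κ R (p i) * Y
        + algebraMap κ R (u i) * Z) D.form
      = Y ^ 2 * Z - X ^ 3 - algebraMap κ R a * X * Z ^ 2 - algebraMap κ R b * Z ^ 3)
    (d : ℕ) :
    ∃ Y : CurveInComplement D, d ≤ Y.degree ∧
      Module.Finite κ (regularDifferentials κ Y.closure.functionField) ∧
      Y.placesAtInfinity.Finite ∧ Y.eulerChar ≤ 0 := by
  classical
  have : CharZero (RatFunc κ) := charZero_of_injective_algebraMap (algebraMap κ _).injective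
  obtain ⟨m, ham, he⟩ := exists_critical_value_ne_zero hab
  set e := b - 2 * m ^ 3 with he_def
  obtain ⟨c, hc⟩ := IsAlgClosed.exists_pow_nat_eq (-3 * e) (n := 2) (by norm_num)
  obtain ⟨β₁, hβ₁⟩ := IsAlgClosed.exists_pow_nat_eq (-e⁻¹) (n := 2) (by norm_num)
  have hc0 : c ≠ 0 := by
    rintro rfl
    simp [he] at hc
  have hβ₁0 : β₁ ≠ 0 := by
    rintro rfl
    simp [he] at hβ₁
  let n := 2 * d + 5
  let C := algebraMap κ (RatFunc κ)
  let s : RatFunc κ := RatFunc.X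
  let q := conicFst (C m) s
  let A := conicFun (C m) (C c) s
  let t := q ^ 2 / 3
  let α := Polynomial.aeval A (Polynomial.Chebyshev.T κ (n + 1))
  let β := C β₁ * Polynomial.aeval A (Polynomial.Chebyshev.U κ n)
  let z := β * (2 * α * q - β * (3 * t ^ 2 + C a))
  let y := q * (1 + 2 * (t ^ 3 + C a * t + C b) * β ^ 2) - α * β * (3 * t ^ 2 + C a)
  let x : Fin 3 → RatFunc κ := fun i => C (v i) * (t * z - 1) + C (p i) * y + C (u i) * z
  have hFx : MvPolynomial.aeval x D.form = 1 := by
    have hq : q ^ 2 = 3 * t := by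
      simp only [t]; field_simp
    have hN : α ^ 2 = 1 + (t ^ 3 + C a * t + C b) * β ^ 2 := by
      have h1 := congrArg (Polynomial.aeval A) (Polynomial.Chebyshev.T_succ_sq κ n)
      simp only [map_pow, map_add, map_sub, map_mul, map_one, Polynomial.aeval_X] at h1
      have h2 : C e * A ^ 2 = -((t - C m) ^ 2 * (t + 2 * C m)) := by
        refine conicFun_sq (m := C m) (c := C c) (s := s) RatFunc.X_ne_zero
          (by simpa [C] using he) ?_
        rw [← map_pow, hc]; simp [map_ofNat]
      have h3 : C β₁ ^ 2 * C e = -1 := by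
        rw [← map_pow, hβ₁, ← map_mul, neg_mul, inv_mul_cancel₀ he]; simp
      have h4 : C a = -3 * C m ^ 2 := by rw [ham]; simp [map_ofNat]
      have h5 : C e = C b - 2 * C m ^ 3 := by rw [he_def]; simp [map_ofNat]
      have h6 : A ^ 2 - 1 = (t ^ 3 + C a * t + C b) * C β₁ ^ 2 := by
        rw [h4]
        linear_combination (A ^ 2 - 1) * h3 - C β₁ ^ 2 * h2 + C β₁ ^ 2 * h5
      rw [h6] at h1
      simp only [β]
      linear_combination h1
    rw [hF]
    exact weierstrass_form_eq_one hq hN rfl rfl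
  -- values at the place `s = s₀`
  have hres {V : ValuationSubring (RatFunc κ)} (hV : ∀ a : κ, algebraMap κ (RatFunc κ) a ∈ V)
      {s₀ : κ} (hs : IsResidue V s s₀) (hs₀ : s₀ ≠ 0) :
      IsResidue V q (conicFst m s₀) ∧
      IsResidue V α ((Polynomial.Chebyshev.T κ (n + 1)).eval (conicFun m c s₀)) ∧
      IsResidue V β (β₁ * (Polynomial.Chebyshev.U κ n).eval (conicFun m c s₀)) :=
    ⟨isResidue_conicFst hV m hs hs₀, (isResidue_conicFun hV m hc0 hs hs₀).aeval hV _,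
      (IsResidue.const V β₁).mul hV ((isResidue_conicFun hV m hc0 hs hs₀).aeval hV _)⟩
  choose! S hS0 hS using fun (r : κ) (hr : r ≠ 0) => exists_conicFun_eq (m := m) he hc hr
  let roots := (Polynomial.Chebyshev.U κ n).roots.toFinset.erase 0
  let 𝒯 : Finset κ := roots.image fun r => conicFst m (S r)
  have hroots : 2 * d + 4 ≤ roots.card := by
    have h1 := Finset.pred_card_le_card_erase (s := (Polynomial.Chebyshev.U κ n).roots.toFinset)
      (a := 0)
    rwa [Polynomial.Chebyshev.card_roots_toFinset_U] at h1
  -- the square of a root is determined by the value of `q`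
  have h𝒯card : d + 2 ≤ 𝒯.card := by
    have := Finset.card_le_mul_card_image (f := fun r => conicFst m (S r)) roots 2 fun τ _ => by
      by_cases hτ : ∃ r ∈ roots, conicFst m (S r) = τ
      · obtain ⟨r, hr, hrτ⟩ := hτ
        refine (Finset.card_le_card (t := {r, -r}) fun r' hr' => ?_).trans Finset.card_le_two
        obtain ⟨hr', hr'τ⟩ := Finset.mem_filter.1 hr'
        have hr0 := Finset.ne_of_mem_erase hr
        have hr'0 := Finset.ne_of_mem_erase hr'
        have h1 := conicFun_sq (m := m) (hS0 r hr0) he hc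
        have h2 := conicFun_sq (m := m) (hS0 r' hr'0) he hc
        rw [hS r hr0, hrτ] at h1
        rw [hS r' hr'0, hr'τ, ← h1] at h2
        simpa using sq_eq_sq_iff_eq_or_eq_neg.1 (mul_left_cancel₀ he h2)
      · push Not at hτ
        rw [Finset.filter_false_of_mem hτ]
        simp
    change roots.card ≤ 2 * 𝒯.card at this
    omega
  have hplace (τ : κ) (hτ : τ ∈ 𝒯) : ∃ V : ValuationSubring (RatFunc κ),
      (∀ a : κ, algebraMap κ (RatFunc κ) a ∈ V) ∧ IsResidue V q τ ∧ IsResidue V β (0 : κ) ∧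
        ∃ α₀ : κ, α₀ ≠ 0 ∧ IsResidue V α α₀ := by
    obtain ⟨r, hr, rfl⟩ := Finset.mem_image.1 hτ
    have hr0 := Finset.ne_of_mem_erase hr
    obtain ⟨V, hV, hVs⟩ := RatFunc.exists_place_at (S r)
    obtain ⟨hq, hα, hβ⟩ := hres hV hVs (hS0 r hr0)
    have hr1 : (Polynomial.Chebyshev.U κ n).eval r = 0 :=
      Polynomial.isRoot_of_mem_roots (Multiset.mem_toFinset.1 (Finset.mem_of_mem_erase hr))
    rw [hS r hr0] at hα hβ
    rw [hr1, mul_zero] at hβ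
    refine ⟨V, hV, hq, hβ, _, fun h => ?_, hα⟩
    have h1 := congrArg (Polynomial.eval r) (Polynomial.Chebyshev.T_succ_sq κ n)
    simp [hr1, h] at h1
  have hreg (V : ValuationSubring (RatFunc κ)) (hV : ∀ a : κ, algebraMap κ (RatFunc κ) a ∈ V)
      (hX : RatFunc.X ∈ V)
      (hT : ∀ α ∈ ({0} : Finset κ), V.valuation (RatFunc.X - algebraMap κ (RatFunc κ) α) = 1) :
      (∀ i, x i ∈ V) ∧ V.valuation (MvPolynomial.aeval x D.form) = 1 := by
    refine ⟨?_, by rw [hFx, map_one]⟩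
    have hX' : (RatFunc.X : RatFunc κ)⁻¹ ∈ V := by
      have := hT 0 (Finset.mem_singleton_self 0)
      rw [map_zero, sub_zero] at this
      rw [← V.valuation_le_one_iff, map_inv₀, this, inv_one]
    have hq : q ∈ V := conicFst_mem hV m hX hX'
    have hA : A ∈ V := conicFun_mem hV m c hX hX'
    have ht : t ∈ V := by
      simp only [t, div_eq_mul_inv]
      exact mul_mem (pow_mem hq 2) (inv_ofNat_mem hV 3)
    have hα : α ∈ V := polynomial_aeval_mem hV hA _
    have hβ : β ∈ V := mul_mem (hV _) (polynomial_aeval_mem hV hA _)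
    have h2 : (2 : RatFunc κ) ∈ V := ofNat_mem V 2
    have h3 : (3 : RatFunc κ) ∈ V := ofNat_mem V 3
    have hg : 3 * t ^ 2 + C a ∈ V := add_mem (mul_mem h3 (pow_mem ht 2)) (hV _)
    have hz : z ∈ V := mul_mem hβ (sub_mem (mul_mem (mul_mem h2 hα) hq) (mul_mem hβ hg))
    have hy : y ∈ V := sub_mem (mul_mem hq (add_mem (one_mem V) (mul_mem (mul_mem h2
      (add_mem (add_mem (pow_mem ht 3) (mul_mem (hV _) ht)) (hV _))) (pow_mem hβ 2))))
      (mul_mem (mul_mem hα hβ) hg)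
    exact fun i => add_mem (add_mem (mul_mem (hV _) (sub_mem (mul_mem ht hz) (one_mem V)))
      (mul_mem (hV _) hy)) (mul_mem (hV _) hz)
  have hres' {V : ValuationSubring (RatFunc κ)} (hV : ∀ a : κ, algebraMap κ (RatFunc κ) a ∈ V)
      {τ : κ} (hq : IsResidue V q τ) :
      IsResidue V t (τ ^ 2 / 3) ∧ IsResidue V (3 * t ^ 2 + C a) (3 * (τ ^ 2 / 3) ^ 2 + a) := by
    have ht : IsResidue V t (τ ^ 2 / 3) := (hq.pow hV 2).div hV (.ofNat V 3) (by norm_num)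
    exact ⟨ht, ((IsResidue.ofNat V 3).mul hV (ht.pow hV 2)).add (.const V a)⟩
  have h𝒯 (τ : κ) (hτ : τ ∈ 𝒯) : MvPolynomial.eval (fun i => (-v) i + τ * p i) D.form ≠ 0 ∧
      ∃ V : ValuationSubring (RatFunc κ), (∀ a : κ, algebraMap κ (RatFunc κ) a ∈ V) ∧
        ∀ i, V.valuation (x i - algebraMap κ (RatFunc κ) ((-v) i + τ * p i)) < 1 := by
    constructor
    · have h := hF κ (-1) τ 0
      simp only [Algebra.algebraMap_self, RingHom.id_apply, MvPolynomial.aeval_eq_eval] at h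
      have e : (fun i => (-v) i + τ * p i) = fun i => v i * -1 + p i * τ + u i * 0 := by
        funext i; simp only [Pi.neg_apply]; ring
      rw [e]
      refine h.trans_ne ?_
      norm_num
    · obtain ⟨V, hV, hq, hβ, α₀, -, hα⟩ := hplace τ hτ
      refine ⟨V, hV, fun i => ?_⟩
      obtain ⟨ht, hg⟩ := hres' hV hq
      have hz := hβ.mul hV ((((IsResidue.ofNat V 2).mul hV hα).mul hV hq).sub (hβ.mul hV hg))
      have h1 : IsResidue V (1 : RatFunc κ) (1 : κ) := by simpa using IsResidue.const V (1 : κ)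
      have hf := ((ht.pow hV 3).add ((IsResidue.const V a).mul hV ht)).add (.const V b)
      have hy := (hq.mul hV (h1.add (((IsResidue.ofNat V 2).mul hV hf).mul hV (hβ.pow hV 2)))).sub
        ((hα.mul hV hβ).mul hV hg)
      have := (((IsResidue.const V (v i)).mul hV ((ht.mul hV hz).sub h1)).add
        ((IsResidue.const V (p i)).mul hV hy)).add ((IsResidue.const V (u i)).mul hV hz)
      refine (congrArg (IsResidue V (x i)) ?_).mpr this
      simp only [Pi.neg_apply, zero_mul, mul_zero]
      ring
  have hz : z ≠ 0 := by
    refine mul_ne_zero ?_ ?_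
    · obtain ⟨V, hV, hVs⟩ := RatFunc.exists_place_at (S 1)
      have hβ := (hres hV hVs (hS0 1 one_ne_zero)).2.2
      refine hβ.ne_zero hV (mul_ne_zero hβ₁0 ?_)
      rw [hS 1 one_ne_zero, Polynomial.Chebyshev.U_eval_one]
      exact_mod_cast Nat.succ_ne_zero n
    · obtain ⟨τ, hτ, hτ0⟩ := Finset.exists_mem_ne (show 1 < 𝒯.card by omega) 0
      obtain ⟨V, hV, hq, hβ, α₀, hα0, hα⟩ := hplace τ hτ
      have := (((IsResidue.ofNat V 2).mul hV hα).mul hV hq).sub (hβ.mul hV (hres' hV hq).2)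
      refine this.ne_zero hV ?_
      simp [hα0, hτ0]
  have hline : ∑ i, C (((-v) ⨯₃ p) i) * x i ≠ 0 := by
    have e : ∑ i, C (((-v) ⨯₃ p) i) * x i = -(C (u ⬝ᵥ v ⨯₃ p) * z) := by
      simp [x, cross_apply, dotProduct, Fin.sum_univ_three]
      ring
    rw [e]
    exact neg_ne_zero.2 (mul_ne_zero (by simpa [C] using hdet) hz)
  obtain ⟨Y, hY, hfin, hpl, hχ⟩ := exists_curveInComplement_of_parametrization D x
    {0} 𝒯 (-v) p hreg h𝒯 hline (by omega)
  exact ⟨Y, by omega, hfin, hpl, hχ.trans (by simp)⟩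

end Weierstrass

/-- The two finiteness clauses make sure that the genus and the number of points at infinity in
`eulerChar` are true counts and not default values. -/
theorem theorem4p1 {κ : Type*} [Field κ] [IsAlgClosed κ] [CharZero κ]
    (D : IrredPlaneCurve κ) (hD : D.degree = 3) (d : ℕ) (hd : 1 ≤ d) :
    ∃ Y : CurveInComplement D, d ≤ Y.degree ∧
      Module.Finite κ (regularDifferentials κ Y.closure.functionField) ∧
      Y.placesAtInfinity.Finite ∧
      Y.eulerChar ≤ 12 := by
  have hF₀ : D.form.IsHomogeneous 3 := by
    have h := D.isHomogeneous
    rwa [hD] at h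
  obtain ⟨v, p, u, hdet, ⟨q, c, hq, hc, hqd, hcd, hF⟩ | ⟨a, b, hab, hF⟩⟩ :=
    exists_normal_form hF₀ D.irreducible
  · obtain ⟨Y, hY, hfin, hS, hχ⟩ := exists_curve_of_linear_form D hdet hq hc hqd hcd hF d
    exact ⟨Y, hY, hfin, hS, hχ.trans (by norm_num)⟩
  · obtain ⟨Y, hY, hfin, hS, hχ⟩ := exists_curve_of_weierstrass_form D hdet hab hF d
    exact ⟨Y, hY, hfin, hS, hχ.trans (by norm_num)⟩
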